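/- **Setting.** Let $d\ge 1$, let $\mathcal D\subset\mathbb R^d$, and let $\{P_v\}_{v\in\mathcal V}$ be compact convex polytopes with disjoint interiors that cover $\mathcal D$, each labelled by a point $v$ of its interior, such that every compact subset of $\mathcal D$ meets only finitely many of them. Two distinct vertices $v,w\in\mathcal V$ are joined by an edge, $(w,v)\in\mathcal E$, if $H_{(w,v)}:=P_w\cap P_v$ has dimension $d-1$. Assume that this tiling is orthogonal: $w-v$ is orthogonal to the hyperplane containing $P_w\cap P_v$ for every edge $(w,v)$. For a function $h$ on vertices put $$\Delta^{\mathcal G}_{\mathbf a}h(v)=\sum_{(w,v)\in\mathcal E}\mathbf a(w,v)\,(h(w)-h(v)),\qquad \mathbf a(w,v)=\frac{\mathrm{vol}_{d-1}(P_w\cap P_v)}{\|w-v\|},$$ and for an edge $e=(w,v)$ let $Q_e=\mathrm{conv}(\{w\}\cup H_e)\cup\mathrm{conv}(\{v\}\cup H_e)$ be its dual polytope. For a bounded domain $U\subset\mathbb R^d$ let $\mathcal V[U]$ be the set of vertices in $U$, let $\partial\mathcal V[U]$ be the set of the other vertices that share an edge with a vertex in $\mathcal V[U]$, let $\overline{\mathcal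 V[U]}=\mathcal V[U]\cup\partial\mathcal V[U]$ and $\widehat U=\bigcup_{v\in\overline{\mathcal V[U]}}P_v$. Let $\widehat U^{+}$ be the union of $\widehat U$ and of the sets $\mathrm{conv}(Q_e)$ for the edges $e$ with both end points in $\mathcal V[U]$. (Here $\mathrm{conv}(Q_e)=Q_e\subset\widehat U$ whenever the segment between the end points of $e$ meets $H_e$.) **Theorem.** Let $U\subset\mathbb R^d$ be a bounded domain and let $F,\alpha>0$. There is a constant $C=C(U,F,\alpha)\in(0,\infty)$ such that the following holds for every $\mathcal D$ and every orthogonal tiling of $\mathcal D$ as above with $\overline U\subset\mathcal D$ for which each $P_v$ with $v\in\mathcal V[U]$ lies in the interior of $\mathcal D$ and $$\mathrm{diam}(P_v)\le F\sup_{e=(w,v)\in\mathcal E}\mathrm{vol}_d(Q_e)^{\alpha}\qquad\text{for all }v\in\mathcal V[U].$$ Let $h_C$ be $C^2$ in a neighbourhood of $\widehat U^{+}$ with $\Delta h_C=0$ on $\widehat U$, and let $h_D:\overline{\mathcal V[U]}\to\mathbb R$ satisfy $$\Delta^{\mathcal G}_{\mathbf a}h_D=0\ \text{ in }\mathcal V[U],\qquad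 h_D=h_C\ \text{ on }\partial\mathcal V[U].$$ Put $\varepsilon=\sup_{v\in\overline{\mathcal V[U]}}\mathrm{diam}(P_v)$ and $M=\max\bigl(\sup_{\widehat U^{+}}|\nabla^2h_C|,1\bigr)$, where $|\cdot|$ is the operator norm. If $\varepsilon<(CM)^{-1}$, then $$\sup_{v\in\mathcal V[U]}|h_D(v)-h_C(v)|\le C\,M\,\varepsilon\,\log(\varepsilon^{-1}).$$ -/

import Mathlib

/-!
By the divergence theorem on the tiles, the network Laplacian of `f = h_C - h_D` at `v` is the
divergence `∑_w θ(w, v)` of an antisymmetric flow `θ`, the difference between the discrete flow of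
`h_C` and the flux of `∇ h_C` through the facets. Taylor's formula bounds `|θ(w, v)|` by
`a(w, v) ‖w - v‖ M r`, where `r` is the larger of the diameters of the two tiles. Let `g` be the
Green function with pole `z` of the network killed on `∂𝒱[U]`. Green's identity expresses `f z` as
`-½ ∑ (g v - g w) θ(w, v)` plus a boundary term of order `M ε`, because `g` sends a unit flow to
the boundary.

In dimension at least two the Dirichlet energy `g z` of `g` is not bounded as `ε → 0`, so the sum
is estimated through the deformed logarithm `(1 - (1 + g)^(-β)) / β` instead. It is at most
`1 / β`, so its energy against `g` is of order `1 / β`; with `β` proportional to `1 / log(ε⁻¹)`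
this is where the logarithm of the theorem comes from. To pay for the deformation the diameters
must decay like `ε (1 + g)^(-β / 2)`. The divergence theorem and orthogonality make the
coordinates discretely harmonic, so the Laplacian of `‖x‖²` is the speed measure
`∑_w a(w, v) ‖w - v‖²`. Hence `g` has bounded integral against it, and the hypothesis on the
diameters gives the decay `(1 + g)^(-α)`, since a dual polytope has volume at most the speed
measure of its end points. Interpolation with the bound `ε` gives the required decay. Finally, the
speed measure of `v` is `d` times the volume of the dual polytopes around `v`, so its total mass is
controlled by the volume of a ball.
-/

open MeasureTheory Set
open scoped InnerProductSpace

noncomputable section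

/-- A tiling of a set `D ⊆ ℝ^d` by closed convex polytopes with disjoint interiors, each of them
labelled by a vertex in its interior. The values of `tile` outside `verts` are irrelevant.
The polytopes cover `D`; they are allowed to reach outside of `D`. -/
structure Tiling (d : ℕ) (D : Set (EuclideanSpace ℝ (Fin d))) where
  /-- The set of vertices. -/
  verts : Set (EuclideanSpace ℝ (Fin d))
  /-- The polytope `P_v` of the vertex `v`. -/
  tile : EuclideanSpace ℝ (Fin d) → Set (EuclideanSpace ℝ (Fin d))
  isPolytope : ∀ v ∈ verts, ∃ s : Set (EuclideanSpace ℝ (Fin d)),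
    s.Finite ∧ tile v = convexHull ℝ s
  mem_interior : ∀ v ∈ verts, v ∈ interior (tile v)
  disjoint_interior : ∀ v ∈ verts, ∀ w ∈ verts, v ≠ w →
    Disjoint (interior (tile v)) (interior (tile w))
  cover : D ⊆ ⋃ v ∈ verts, tile v
  locallyFinite : ∀ K ⊆ D, IsCompact K → {v ∈ verts | (tile v ∩ K).Nonempty}.Finite

namespace Tiling

variable {d : ℕ} {D : Set (EuclideanSpace ℝ (Fin d))} (G : Tiling d D)

/-- The intersection `H_e = P_w ∩ P_v` of two tiles. -/
def facet (w v : EuclideanSpace ℝ (Fin d)) : Set (EuclideanSpace ℝ (Fin d)) :=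
  G.tile w ∩ G.tile v

/-- Two distinct vertices are joined by an edge if their tiles meet in a set of
dimension `d - 1`. -/
def Adj (w v : EuclideanSpace ℝ (Fin d)) : Prop :=
  w ∈ G.verts ∧ v ∈ G.verts ∧ w ≠ v ∧ (G.facet w v).Nonempty ∧
    Module.finrank ℝ (affineSpan ℝ (G.facet w v)).direction + 1 = d

/-- For each edge `(w, v)`, the vector `w - v` is orthogonal to the hyperplane containing
`P_w ∩ P_v`. -/
def IsOrthogonal : Prop :=
  ∀ w v, G.Adj w v → ∀ u ∈ (affineSpan ℝ (G.facet w v)).direction, ⟪w - v, u⟫_ℝ = 0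

/-- The conductance `vol_{d-1}(P_w ∩ P_v) / ‖w - v‖`. -/
def cond (w v : EuclideanSpace ℝ (Fin d)) : ℝ :=
  (μHE[d - 1]).real (G.facet w v) / ‖w - v‖

/-- The discrete Laplacian, `∑_{w ∼ v} a(w, v) (h w - h v)`. -/
def discreteLaplacian (h : EuclideanSpace ℝ (Fin d) → ℝ) (v : EuclideanSpace ℝ (Fin d)) : ℝ :=
  ∑ᶠ w ∈ {w | G.Adj w v}, G.cond w v * (h w - h v)

/-- The vertices `𝒱[U]` in the interior of `U`. -/
def vertsIn (U : Set (EuclideanSpace ℝ (Fin d))) : Set (EuclideanSpace ℝ (Fin d)) :=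
  G.verts ∩ interior U

/-- The boundary `∂𝒱[U]`: the vertices outside of `𝒱[U]` that share an edge with a vertex
in `𝒱[U]`. -/
def bdryVerts (U : Set (EuclideanSpace ℝ (Fin d))) : Set (EuclideanSpace ℝ (Fin d)) :=
  {w | w ∉ G.vertsIn U ∧ ∃ v ∈ G.vertsIn U, G.Adj w v}

/-- The closure `𝒱[U] ∪ ∂𝒱[U]`. -/
def closedVerts (U : Set (EuclideanSpace ℝ (Fin d))) : Set (EuclideanSpace ℝ (Fin d)) :=
  G.vertsIn U ∪ G.bdryVerts U

/-- The dual polytope `Q_e` of the edge `e = (w, v)`. -/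
def dualPolytope (w v : EuclideanSpace ℝ (Fin d)) : Set (EuclideanSpace ℝ (Fin d)) :=
  convexHull ℝ (insert w (G.facet w v)) ∪ convexHull ℝ (insert v (G.facet w v))

/-- The union `Û` of the tiles whose vertices lie in or are adjacent to `U`. -/
def hat (U : Set (EuclideanSpace ℝ (Fin d))) : Set (EuclideanSpace ℝ (Fin d)) :=
  ⋃ v ∈ G.closedVerts U, G.tile v

/-- The set `Û` together with the convex hulls of the dual polytopes `Q_e` of the edges `e` between
two vertices in `𝒱[U]`. The hull of `Q_e` differs from `Q_e ⊆ Û` only if the segment between the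
end points of `e` misses the facet `H_e`. -/
def hatHull (U : Set (EuclideanSpace ℝ (Fin d))) : Set (EuclideanSpace ℝ (Fin d)) :=
  G.hat U ∪ ⋃ w ∈ G.vertsIn U, ⋃ v ∈ G.vertsIn U, ⋃ _ : G.Adj w v,
    convexHull ℝ (G.dualPolytope w v)

/-- The mesh `ε`, the largest diameter of a tile with vertex in `𝒱[U] ∪ ∂𝒱[U]`. -/
def mesh (U : Set (EuclideanSpace ℝ (Fin d))) : ℝ :=
  sSup ((fun v => Metric.diam (G.tile v)) '' G.closedVerts U)

/-- The supremum of `vol_d(Q_e) ^ α` over the edges `e` incident to `v`. -/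
def maxDualVolume (α : ℝ) (v : EuclideanSpace ℝ (Fin d)) : ℝ :=
  sSup ((fun w => (volume.real (G.dualPolytope w v)) ^ α) '' {w | G.Adj w v})

end Tiling

/-- `M = (sup_K |∇² h|) ∨ 1`, with the operator norm of the second derivative. -/
def hessianBound {d : ℕ} (h : EuclideanSpace ℝ (Fin d) → ℝ)
    (K : Set (EuclideanSpace ℝ (Fin d))) : ℝ :=
  max (sSup ((fun x => ‖iteratedFDeriv ℝ 2 h x‖) '' K)) 1

end

section Network

variable {ι : Type*} [Fintype ι]

/-- The Laplacian of a finite network in which the edge between `w` and `v` has conductance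
`a w v`. -/
noncomputable def networkLaplacian (a : ι → ι → ℝ) : (ι → ℝ) →ₗ[ℝ] ι → ℝ :=
  LinearMap.pi fun v => ∑ w, a w v • ((LinearMap.proj w : (ι → ℝ) →ₗ[ℝ] ℝ) - LinearMap.proj v)

theorem sum_mul_eq_sum_mul_of_eq_zero {V : Finset ι} {g : ι → ℝ} (hg : ∀ v ∉ V, g v = 0)
    (u : ι → ℝ) : ∑ v, g v * u v = ∑ v ∈ V, g v * u v :=
  (Finset.sum_subset (Finset.subset_univ V) fun v _ hv => by rw [hg v hv, zero_mul]).symm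

variable {a : ι → ι → ℝ}

theorem networkLaplacian_apply (u : ι → ℝ) (v : ι) :
    networkLaplacian a u v = ∑ w, a w v * (u w - u v) := by
  simp [networkLaplacian]

theorem sum_mul_networkLaplacian_eq_energy (hsymm : ∀ v w, a v w = a w v) (u g : ι → ℝ) :
    ∑ v, u v * networkLaplacian a g v =
      -(1 / 2) * ∑ v, ∑ w, a w v * ((u w - u v) * (g w - g v)) := by
  have hleft : ∑ v, u v * networkLaplacian a g v = ∑ v, ∑ w, a w v * (u v * (g w - g v)) := by
    simp only [networkLaplacian_apply, Finset.mul_sum]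
    exact Finset.sum_congr rfl fun v _ => Finset.sum_congr rfl fun w _ => by ring
  have hswap : ∑ v, u v * networkLaplacian a g v = ∑ v, ∑ w, a w v * (u w * (g v - g w)) := by
    rw [hleft, Finset.sum_comm]
    exact Finset.sum_congr rfl fun v _ => Finset.sum_congr rfl fun w _ => by rw [hsymm v w]
  have hsum : ∑ v, ∑ w, a w v * ((u w - u v) * (g w - g v)) =
      -(∑ v, ∑ w, a w v * (u v * (g w - g v)) + ∑ v, ∑ w, a w v * (u w * (g v - g w))) := by
    simp only [← Finset.sum_add_distrib, ← Finset.sum_neg_distrib]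
    exact Finset.sum_congr rfl fun v _ => Finset.sum_congr rfl fun w _ => by ring
  rw [hsum, ← hleft, ← hswap]
  ring

theorem sum_mul_networkLaplacian_comm (hsymm : ∀ v w, a v w = a w v) (u g : ι → ℝ) :
    ∑ v, u v * networkLaplacian a g v = ∑ v, g v * networkLaplacian a u v := by
  simp only [sum_mul_networkLaplacian_eq_energy hsymm, mul_comm (u _ - u _)]

variable {E : Type*} [NormedAddCommGroup E]

/-- The speed measure `∑_w a(w, v) ‖x w - x v‖²` of a network embedded in a normed space. -/
noncomputable def speedMeasure (a : ι → ι → ℝ) (x : ι → E) (v : ι) : ℝ :=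
  ∑ w, a w v * ‖x w - x v‖ ^ 2

theorem speedMeasure_nonneg (ha : ∀ v w, 0 ≤ a v w) (x : ι → E) (v : ι) :
    0 ≤ speedMeasure a x v :=
  Finset.sum_nonneg fun w _ => mul_nonneg (ha w v) (sq_nonneg _)

variable [InnerProductSpace ℝ E]

theorem networkLaplacian_norm_sq_sub {x : ι → E} {v : ι} (c : ℝ)
    (hbalance : ∑ w, a w v • (x w - x v) = 0) :
    networkLaplacian a (fun w => ‖x w‖ ^ 2 - c) v = speedMeasure a x v := by
  have hcross : ∑ w, a w v * ⟪x v, x w - x v⟫_ℝ = 0 := by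
    simpa [inner_sum, inner_smul_right] using congrArg (⟪x v, ·⟫_ℝ) hbalance
  calc networkLaplacian a (fun w => ‖x w‖ ^ 2 - c) v
      = speedMeasure a x v + 2 * ∑ w, a w v * ⟪x v, x w - x v⟫_ℝ := by
        rw [networkLaplacian_apply, speedMeasure, Finset.mul_sum, ← Finset.sum_add_distrib]
        refine Finset.sum_congr rfl fun w _ => ?_
        rw [norm_sub_sq_real, inner_sub_right, real_inner_self_eq_norm_sq, real_inner_comm]
        ring
    _ = speedMeasure a x v := by rw [hcross, mul_zero, add_zero]

/-- A network of symmetric nonnegative conductances, embedded in the ball of radius `R`, whose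
embedding is harmonic at the vertices in `V`: the coordinates of `x` have Laplacian zero there. -/
structure IsBalancedNetwork (a : ι → ι → ℝ) (x : ι → E) (V : Finset ι) (R : ℝ) : Prop where
  symm : ∀ v w, a v w = a w v
  nonneg : ∀ v w, 0 ≤ a v w
  norm_le : ∀ v, ‖x v‖ ≤ R
  sum_smul_sub_eq_zero : ∀ v ∈ V, ∑ w, a w v • (x w - x v) = 0
  speedMeasure_pos : ∀ v ∈ V, 0 < speedMeasure a x v

namespace IsBalancedNetwork

variable {x : ι → E} {V : Finset ι} {R : ℝ}

theorem norm_sq_sub_nonpos (hN : IsBalancedNetwork a x V R) (v : ι) : ‖x v‖ ^ 2 - R ^ 2 ≤ 0 :=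
  sub_nonpos.2 (pow_le_pow_left₀ (norm_nonneg _) (hN.norm_le v) 2)

/-- Since `‖x‖² - R²` is nonpositive and strictly subharmonic in `V`, subtracting a small multiple
of it moves every minimum out of `V`. -/
theorem neg_mul_sq_le_of_networkLaplacian_nonpos (hN : IsBalancedNetwork a x V R) {u : ι → ℝ}
    (hu : ∀ v ∈ V, networkLaplacian a u v ≤ 0) (hb : ∀ v ∉ V, 0 ≤ u v) {δ : ℝ} (hδ : 0 < δ)
    (v : ι) : -(δ * R ^ 2) ≤ u v := by
  set q : ι → ℝ := fun w => ‖x w‖ ^ 2 - R ^ 2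
  have : Nonempty ι := ⟨v⟩
  obtain ⟨z, hz⟩ := Finite.exists_min (u - δ • q)
  have hzV : z ∉ V := fun hzV => by
    have hmin : 0 ≤ networkLaplacian a (u - δ • q) z := by
      rw [networkLaplacian_apply]
      exact Finset.sum_nonneg fun w _ => mul_nonneg (hN.nonneg w z) (sub_nonneg.2 (hz w))
    rw [map_sub, map_smul, Pi.sub_apply, Pi.smul_apply, smul_eq_mul,
      networkLaplacian_norm_sq_sub _ (hN.sum_smul_sub_eq_zero z hzV)] at hmin
    linarith [hu z hzV, mul_pos hδ (hN.speedMeasure_pos z hzV)]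
  have hvz : u z - δ * q z ≤ u v - δ * q v := hz v
  have hqz : 0 ≤ u z - δ * q z := by
    linarith [hb z hzV, mul_nonneg hδ.le (neg_nonneg.2 (hN.norm_sq_sub_nonpos z))]
  have hqv : -(δ * R ^ 2) ≤ δ * q v := by
    linarith [mul_nonneg hδ.le (sq_nonneg ‖x v‖), mul_sub δ (‖x v‖ ^ 2) (R ^ 2)]
  linarith

theorem nonneg_of_networkLaplacian_nonpos (hN : IsBalancedNetwork a x V R) {u : ι → ℝ}
    (hu : ∀ v ∈ V, networkLaplacian a u v ≤ 0) (hb : ∀ v ∉ V, 0 ≤ u v) : 0 ≤ u := by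
  refine fun v => le_of_forall_pos_le_add fun η hη => ?_
  have hscale : η / (R ^ 2 + 1) * R ^ 2 ≤ η := by
    rw [div_mul_eq_mul_div, div_le_iff₀ (by positivity)]
    nlinarith
  have := hN.neg_mul_sq_le_of_networkLaplacian_nonpos hu hb
    (show 0 < η / (R ^ 2 + 1) by positivity) v
  rw [Pi.zero_apply]
  linarith

end IsBalancedNetwork

variable [DecidableEq ι]

/-- `g` is the Green function with pole `z` of the network with killing outside of `V`. -/
structure IsGreenFunction (a : ι → ι → ℝ) (V : Finset ι) (z : ι) (g : ι → ℝ) : Prop where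
  nonneg : ∀ v, 0 ≤ g v
  eq_zero : ∀ v ∉ V, g v = 0
  networkLaplacian_eq : ∀ v ∈ V, networkLaplacian a g v = if v = z then -1 else 0

theorem IsBalancedNetwork.exists_isGreenFunction {x : ι → E} {V : Finset ι} {R : ℝ}
    (hN : IsBalancedNetwork a x V R) (z : ι) : ∃ g, IsGreenFunction a V z g := by
  let T : (ι → ℝ) →ₗ[ℝ] (ι → ℝ) := LinearMap.pi fun v =>
    if v ∈ V then LinearMap.proj v ∘ₗ networkLaplacian a else LinearMap.proj v
  have hT : ∀ u, ∀ v ∈ V, T u v = networkLaplacian a u v := fun u v hv => by simp [T, hv]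
  have hT' : ∀ u, ∀ v ∉ V, T u v = u v := fun u v hv => by simp [T, hv]
  have hmax : ∀ u, (∀ v ∈ V, T u v ≤ 0) → (∀ v ∉ V, 0 ≤ T u v) → 0 ≤ u := fun u h h' =>
    hN.nonneg_of_networkLaplacian_nonpos (fun v hv => hT u v hv ▸ h v hv)
      fun v hv => hT' u v hv ▸ h' v hv
  have hinj : Function.Injective T := (injective_iff_map_eq_zero T).2 fun u hu =>
    le_antisymm (neg_nonneg.1 (hmax (-u) (by simp [hu]) (by simp [hu])))
      (hmax u (by simp [hu]) (by simp [hu]))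
  obtain ⟨g, hg⟩ := LinearMap.injective_iff_surjective.1 hinj
    fun v => if v ∈ V then (if v = z then -1 else 0) else 0
  have hgV : ∀ v ∈ V, T g v = if v = z then -1 else 0 := fun v hv => by simp [hg, hv]
  have hgV' : ∀ v ∉ V, T g v = 0 := fun v hv => by simp [hg, hv]
  refine ⟨g, hmax g (fun v hv => ?_) fun v hv => (hgV' v hv).ge,
    fun v hv => hT' g v hv ▸ hgV' v hv, fun v hv => hT g v hv ▸ hgV v hv⟩
  rw [hgV v hv]
  split_ifs <;> norm_num

namespace IsGreenFunction

variable {x : ι → E} {V : Finset ι} {R A : ℝ} {z : ι} {g : ι → ℝ}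

theorem networkLaplacian_nonneg (hg : IsGreenFunction a V z g) (ha : ∀ v w, 0 ≤ a v w) {v : ι}
    (hv : v ∉ V) : 0 ≤ networkLaplacian a g v := by
  rw [networkLaplacian_apply]
  refine Finset.sum_nonneg fun w _ => mul_nonneg (ha w v) ?_
  rw [hg.eq_zero v hv, sub_zero]
  exact hg.nonneg w

theorem sum_mul_networkLaplacian (hg : IsGreenFunction a V z g) (hz : z ∈ V) (u : ι → ℝ) :
    ∑ v, u v * networkLaplacian a g v = -u z + ∑ v ∈ Vᶜ, u v * networkLaplacian a g v := by
  rw [← Finset.sum_add_sum_compl V,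
    Finset.sum_congr rfl fun v hv => by rw [hg.networkLaplacian_eq v hv]]
  simp [hz]

theorem sum_compl_networkLaplacian (hg : IsGreenFunction a V z g)
    (hsymm : ∀ v w, a v w = a w v) (hz : z ∈ V) :
    ∑ v ∈ Vᶜ, networkLaplacian a g v = 1 := by
  have htotal := hg.sum_mul_networkLaplacian hz fun _ => 1
  rw [sum_mul_networkLaplacian_eq_energy hsymm] at htotal
  simp only [sub_self, zero_mul, mul_zero, Finset.sum_const_zero, one_mul] at htotal
  linarith

theorem sum_mul_networkLaplacian_eq_neg (hg : IsGreenFunction a V z g)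
    (hsymm : ∀ v w, a v w = a w v) (hz : z ∈ V) {f : ι → ℝ} (hf : ∀ v ∉ V, f v = 0) :
    ∑ v ∈ V, g v * networkLaplacian a f v = -f z := by
  rw [← sum_mul_eq_sum_mul_of_eq_zero hg.eq_zero, ← sum_mul_networkLaplacian_comm hsymm,
    hg.sum_mul_networkLaplacian hz, Finset.sum_eq_zero fun v hv => ?_, add_zero]
  rw [hf v (Finset.mem_compl.1 hv), zero_mul]

theorem energy_comp_eq (hg : IsGreenFunction a V z g) (hsymm : ∀ v w, a v w = a w v)
    (hz : z ∈ V) {φ : ℝ → ℝ} (hφ : φ 0 = 0) :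
    ∑ v, ∑ w, a w v * ((φ (g w) - φ (g v)) * (g w - g v)) = 2 * φ (g z) := by
  have hzero : ∀ v ∈ Vᶜ, φ (g v) * networkLaplacian a g v = 0 := fun v hv => by
    rw [hg.eq_zero v (Finset.mem_compl.1 hv), hφ, zero_mul]
  have hrep := hg.sum_mul_networkLaplacian hz fun v => φ (g v)
  rw [sum_mul_networkLaplacian_eq_energy hsymm, Finset.sum_eq_zero hzero] at hrep
  linarith

theorem sum_mul_speedMeasure_le (hg : IsGreenFunction a V z g)
    (hN : IsBalancedNetwork a x V R) (hz : z ∈ V) :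
    ∑ v ∈ V, g v * speedMeasure a x v ≤ R ^ 2 := by
  have hrep := hg.sum_mul_networkLaplacian hz fun w => ‖x w‖ ^ 2 - R ^ 2
  rw [sum_mul_networkLaplacian_comm hN.symm, sum_mul_eq_sum_mul_of_eq_zero hg.eq_zero,
    Finset.sum_congr rfl fun v hv => by
      rw [networkLaplacian_norm_sq_sub _ (hN.sum_smul_sub_eq_zero v hv)]] at hrep
  have hbdry : ∑ v ∈ Vᶜ, (‖x v‖ ^ 2 - R ^ 2) * networkLaplacian a g v ≤ 0 :=
    Finset.sum_nonpos fun v hv => mul_nonpos_of_nonpos_of_nonneg (hN.norm_sq_sub_nonpos v)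
      (hg.networkLaplacian_nonneg hN.nonneg (Finset.mem_compl.1 hv))
  linarith [sq_nonneg ‖x z‖]

theorem speedMeasure_mul_one_add_le (hg : IsGreenFunction a V z g)
    (hN : IsBalancedNetwork a x V R) (hA : ∑ v ∈ V, speedMeasure a x v ≤ A) (hz : z ∈ V)
    {v : ι} (hv : v ∈ V) : speedMeasure a x v * (1 + g v) ≤ A + R ^ 2 := by
  have hnonneg := speedMeasure_nonneg hN.nonneg x
  linarith [hg.sum_mul_speedMeasure_le hN hz,
    Finset.single_le_sum (fun w _ => hnonneg w) hv,
    Finset.single_le_sum (f := fun w => g w * speedMeasure a x w)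
      (fun w _ => mul_nonneg (hg.nonneg w) (hnonneg w)) hv]

theorem sum_sum_mul_norm_sq_le (hg : IsGreenFunction a V z g)
    (hN : IsBalancedNetwork a x V R) (hA : ∑ v ∈ V, speedMeasure a x v ≤ A) (hz : z ∈ V) :
    ∑ v ∈ V, ∑ w ∈ V, a w v * (‖x w - x v‖ ^ 2 * (1 + g v + g w)) ≤ A + 2 * R ^ 2 := by
  have hweighted : ∀ u : ι → ℝ, (∀ v, 0 ≤ u v) →
      ∑ v ∈ V, ∑ w ∈ V, u v * (a w v * ‖x w - x v‖ ^ 2) ≤ ∑ v ∈ V, u v * speedMeasure a x v :=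
    fun u hu => Finset.sum_le_sum fun v _ => by
      rw [speedMeasure, Finset.mul_sum]
      exact Finset.sum_le_sum_of_subset_of_nonneg (Finset.subset_univ _) fun w _ _ =>
        mul_nonneg (hu v) (mul_nonneg (hN.nonneg w v) (sq_nonneg _))
  have hswap : ∑ v ∈ V, ∑ w ∈ V, g w * (a w v * ‖x w - x v‖ ^ 2) =
      ∑ v ∈ V, ∑ w ∈ V, g v * (a w v * ‖x w - x v‖ ^ 2) := by
    rw [Finset.sum_comm]
    simp only [hN.symm, norm_sub_rev]
  have hone := hweighted 1 fun _ => zero_le_one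
  have hgreen := hweighted g hg.nonneg
  simp only [Pi.one_apply, one_mul] at hone
  calc ∑ v ∈ V, ∑ w ∈ V, a w v * (‖x w - x v‖ ^ 2 * (1 + g v + g w))
      = ∑ v ∈ V, ∑ w ∈ V, a w v * ‖x w - x v‖ ^ 2 +
        ∑ v ∈ V, ∑ w ∈ V, g v * (a w v * ‖x w - x v‖ ^ 2) +
        ∑ v ∈ V, ∑ w ∈ V, g w * (a w v * ‖x w - x v‖ ^ 2) := by
        simp only [← Finset.sum_add_distrib]
        exact Finset.sum_congr rfl fun v _ => Finset.sum_congr rfl fun w _ => by ring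
    _ ≤ A + 2 * R ^ 2 := by linarith [hg.sum_mul_speedMeasure_le hN hz]

end IsGreenFunction

end Network

section DeformedLog

/-- The deformed logarithm `(1 - X ^ (-β)) / β`, which tends to `log X` as `β → 0` and is bounded
by `1 / β`. -/
noncomputable def deformedLog (β X : ℝ) : ℝ :=
  (1 - X ^ (-β)) / β

variable {β X Y : ℝ}

@[simp]
theorem deformedLog_one (β : ℝ) : deformedLog β 1 = 0 := by
  simp [deformedLog]

theorem deformedLog_le_one_div (hβ : 0 < β) (hX : 0 ≤ X) : deformedLog β X ≤ 1 / β := by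
  unfold deformedLog
  gcongr
  linarith [Real.rpow_nonneg hX (-β)]

theorem deformedLog_le_deformedLog (hβ : 0 < β) (hX : 0 < X) (hXY : X ≤ Y) :
    deformedLog β X ≤ deformedLog β Y := by
  unfold deformedLog
  gcongr 2
  exact Real.rpow_le_rpow_of_nonpos hX hXY (neg_nonpos.2 hβ.le)

theorem sub_mul_deformedLog_sub_nonneg (hβ : 0 < β) (hX : 0 < X) (hY : 0 < Y) :
    0 ≤ (Y - X) * (deformedLog β Y - deformedLog β X) := by
  rcases le_total X Y with h | h
  · exact mul_nonneg (sub_nonneg.2 h) (sub_nonneg.2 (deformedLog_le_deformedLog hβ hX h))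
  · exact mul_nonneg_of_nonpos_of_nonpos (sub_nonpos.2 h)
      (sub_nonpos.2 (deformedLog_le_deformedLog hβ hY h))

/-- Bernoulli's inequality for the exponent `β ≤ 1`, applied to `X / Y`. -/
theorem rpow_neg_mul_le_deformedLog_sub (hβ : 0 < β) (hβ1 : β ≤ 1) (hX : 0 < X) (hXY : X ≤ Y) :
    X ^ (-β) * ((Y - X) / Y) ≤ deformedLog β Y - deformedLog β X := by
  have hY : 0 < Y := hX.trans_le hXY
  have hbernoulli := rpow_one_add_le_one_add_mul_self (s := X / Y - 1)
    (by linarith [div_pos hX hY]) hβ.le hβ1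
  rw [add_sub_cancel, Real.div_rpow hX.le hY.le] at hbernoulli
  have hsplit : Y ^ (-β) = X ^ (-β) * (X ^ β / Y ^ β) := by
    rw [Real.rpow_neg hX.le, Real.rpow_neg hY.le]
    field_simp
  rw [deformedLog, deformedLog, ← sub_div, hsplit, le_div_iff₀ hβ, sub_div, div_self hY.ne']
  nlinarith [mul_le_mul_of_nonneg_left hbernoulli (Real.rpow_nonneg hX.le (-β))]

theorem mul_mul_sub_le_of_le {ε r D k : ℝ} (hε : 0 < ε) (hβ : 0 < β) (hβ1 : β ≤ 1)
    (hX : 1 ≤ X) (hXY : X ≤ Y) (hr0 : 0 ≤ r) (hr : r ≤ k * ε * X ^ (-(β / 2))) :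
    D * r * (Y - X) ≤ ε / 2 * (D ^ 2 * (X + Y - 1)) +
      k ^ 2 * ε / 2 * ((Y - X) * (deformedLog β Y - deformedLog β X)) := by
  have hX0 : 0 < X := by linarith
  have hY : 0 < Y := by linarith
  have : 0 ≤ Y - X := sub_nonneg.2 hXY
  have hr_sq : r ^ 2 ≤ k ^ 2 * ε ^ 2 * X ^ (-β) := by
    calc r ^ 2 ≤ (k * ε * X ^ (-(β / 2))) ^ 2 := pow_le_pow_left₀ hr0 hr 2
      _ = k ^ 2 * ε ^ 2 * X ^ (-β) := by
        rw [mul_pow, mul_pow, ← Real.rpow_natCast (X ^ _), ← Real.rpow_mul hX0.le]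
        congr 2
        push_cast
        ring
  have hyoung : D * r * (Y - X) ≤
      ε / 2 * (D ^ 2 * Y) + r ^ 2 * ((Y - X) * ((Y - X) / Y)) / (2 * ε) := by
    have hsq : 0 ≤ (ε * D * Y - r * (Y - X)) ^ 2 / (2 * ε * Y) := by positivity
    have hexpand : (ε * D * Y - r * (Y - X)) ^ 2 / (2 * ε * Y) = ε / 2 * (D ^ 2 * Y) +
        r ^ 2 * ((Y - X) * ((Y - X) / Y)) / (2 * ε) - D * r * (Y - X) := by
      field_simp
      ring
    linarith
  have henergy : r ^ 2 * ((Y - X) * ((Y - X) / Y)) / (2 * ε) ≤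
      k ^ 2 * ε / 2 * ((Y - X) * (deformedLog β Y - deformedLog β X)) := by
    rw [div_le_iff₀ (by positivity)]
    calc r ^ 2 * ((Y - X) * ((Y - X) / Y))
        ≤ k ^ 2 * ε ^ 2 * X ^ (-β) * ((Y - X) * ((Y - X) / Y)) := by gcongr
      _ = k ^ 2 * ε ^ 2 * ((Y - X) * (X ^ (-β) * ((Y - X) / Y))) := by ring
      _ ≤ k ^ 2 * ε ^ 2 * ((Y - X) * (deformedLog β Y - deformedLog β X)) := by
        gcongr
        exact rpow_neg_mul_le_deformedLog_sub hβ hβ1 hX0 hXY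
      _ = _ := by ring
  have hmono : ε / 2 * (D ^ 2 * Y) ≤ ε / 2 * (D ^ 2 * (X + Y - 1)) := by
    gcongr
    linarith
  linarith

theorem mul_mul_abs_sub_le {ε r D k : ℝ} (hε : 0 < ε) (hβ : 0 < β) (hβ1 : β ≤ 1)
    (hX : 1 ≤ X) (hY : 1 ≤ Y) (hr0 : 0 ≤ r) (hr : r ≤ k * ε * min X Y ^ (-(β / 2))) :
    D * r * |Y - X| ≤ ε / 2 * (D ^ 2 * (X + Y - 1)) +
      k ^ 2 * ε / 2 * ((Y - X) * (deformedLog β Y - deformedLog β X)) := by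
  rcases le_total X Y with h | h
  · rw [min_eq_left h] at hr
    rw [abs_of_nonneg (sub_nonneg.2 h)]
    exact mul_mul_sub_le_of_le hε hβ hβ1 hX h hr0 hr
  · rw [min_eq_right h] at hr
    rw [abs_of_nonpos (sub_nonpos.2 h)]
    linarith [mul_mul_sub_le_of_le (D := D) hε hβ hβ1 hY h hr0 hr]

/-- Interpolation between a uniform bound and a power-law bound. The loss in the first is the
factor `(exp (-L)) ^ (-1 / L) = e`. -/
theorem le_mul_rpow_of_le_exp_of_le {L r B α : ℝ} (hL : 1 ≤ L) (hr0 : 0 ≤ r)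
    (hr : r ≤ Real.exp (-L)) (hB : 1 ≤ B) (hX : 0 < X) (hrX : r ≤ B * X ^ (-α)) :
    r ≤ Real.exp 1 * B * Real.exp (-L) * X ^ (-(α / L)) := by
  have hL0 : 0 < L := by linarith
  have hs1 : 1 / L ≤ 1 := (div_le_one hL0).2 hL
  have huniform : r ^ (1 - 1 / L) ≤ Real.exp 1 * Real.exp (-L) := by
    calc r ^ (1 - 1 / L) ≤ Real.exp (-L) ^ (1 - 1 / L) :=
          Real.rpow_le_rpow hr0 hr (by linarith)
      _ = Real.exp 1 * Real.exp (-L) := by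
        rw [← Real.exp_mul, ← Real.exp_add]
        congr 1
        field_simp
        ring
  have hpower : r ^ (1 / L) ≤ B * X ^ (-(α / L)) := by
    calc r ^ (1 / L) ≤ (B * X ^ (-α)) ^ (1 / L) := Real.rpow_le_rpow hr0 hrX (by positivity)
      _ = B ^ (1 / L) * X ^ (-(α / L)) := by
        rw [Real.mul_rpow (by linarith) (Real.rpow_nonneg hX.le _), ← Real.rpow_mul hX.le]
        congr 2
        ring
      _ ≤ B * X ^ (-(α / L)) := by
        gcongr
        exact Real.rpow_le_self_of_one_le hB hs1
  calc r = r ^ (1 - 1 / L) * r ^ (1 / L) := by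
        rw [← Real.rpow_add' hr0 (by norm_num), sub_add_cancel, Real.rpow_one]
    _ ≤ (Real.exp 1 * Real.exp (-L)) * (B * X ^ (-(α / L))) := by gcongr
    _ = _ := by ring

end DeformedLog

section SupBound

variable {ι : Type*} [Fintype ι] [DecidableEq ι] {E : Type*} [NormedAddCommGroup E]
  [InnerProductSpace ℝ E] {a : ι → ι → ℝ} {x : ι → E} {V : Finset ι} {R A M : ℝ} {z : ι}
  {g f r : ι → ℝ} {θ : ι → ι → ℝ}

omit [Fintype ι] [DecidableEq ι] in
theorem sum_sum_mul_flow_eq_half_sum (g : ι → ℝ) (hθ : ∀ v ∈ V, ∀ w ∈ V, θ w v = -θ v w) :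
    ∑ v ∈ V, ∑ w ∈ V, g v * θ w v = (1 / 2) * ∑ v ∈ V, ∑ w ∈ V, (g v - g w) * θ w v := by
  have hswap : ∑ v ∈ V, ∑ w ∈ V, g v * θ w v = -∑ v ∈ V, ∑ w ∈ V, g w * θ w v := by
    rw [Finset.sum_comm, ← Finset.sum_neg_distrib]
    refine Finset.sum_congr rfl fun v hv => ?_
    rw [← Finset.sum_neg_distrib]
    exact Finset.sum_congr rfl fun w hw => by rw [hθ w hw v hv, mul_neg]
  simp only [sub_mul, Finset.sum_sub_distrib]
  linarith

namespace IsGreenFunction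

theorem neg_eq_sum_mul_flow (hg : IsGreenFunction a V z g) (hsymm : ∀ v w, a v w = a w v)
    (hz : z ∈ V) (hf : ∀ v ∉ V, f v = 0)
    (hθf : ∀ v ∈ V, networkLaplacian a f v = ∑ w, θ w v)
    (hθ : ∀ v ∈ V, ∀ w ∈ V, θ w v = -θ v w) :
    -f z = (1 / 2) * ∑ v ∈ V, ∑ w ∈ V, (g v - g w) * θ w v +
      ∑ v ∈ V, ∑ w ∈ Vᶜ, g v * θ w v := by
  rw [← hg.sum_mul_networkLaplacian_eq_neg hsymm hz hf, ← sum_sum_mul_flow_eq_half_sum g hθ,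
    ← Finset.sum_add_distrib]
  refine Finset.sum_congr rfl fun v hv => ?_
  rw [hθf v hv, Finset.mul_sum, Finset.sum_add_sum_compl]

theorem abs_sum_boundary_flow_le (hg : IsGreenFunction a V z g)
    (hN : IsBalancedNetwork a x V R) (hz : z ∈ V) (hM : 0 ≤ M)
    (hθ : ∀ v ∈ V, ∀ w ∉ V, |θ w v| ≤ a w v * M) :
    |∑ v ∈ V, ∑ w ∈ Vᶜ, g v * θ w v| ≤ M := by
  have hedge : ∀ v ∈ V, ∀ w ∈ Vᶜ, |g v * θ w v| ≤ M * (a v w * (g v - g w)) := by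
    intro v hv w hw
    rw [Finset.mem_compl] at hw
    rw [abs_mul, abs_of_nonneg (hg.nonneg v), hg.eq_zero w hw, sub_zero]
    calc g v * |θ w v| ≤ g v * (a w v * M) :=
          mul_le_mul_of_nonneg_left (hθ v hv w hw) (hg.nonneg v)
      _ = M * (a v w * g v) := by rw [hN.symm w v]; ring
  have hlaplacian : ∀ w ∈ Vᶜ, ∑ v ∈ V, a v w * (g v - g w) ≤ networkLaplacian a g w := by
    intro w hw
    rw [networkLaplacian_apply]
    refine Finset.sum_le_sum_of_subset_of_nonneg (Finset.subset_univ _) fun v _ _ =>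
      mul_nonneg (hN.nonneg v w) ?_
    rw [hg.eq_zero w (Finset.mem_compl.1 hw), sub_zero]
    exact hg.nonneg v
  calc |∑ v ∈ V, ∑ w ∈ Vᶜ, g v * θ w v| ≤ ∑ v ∈ V, ∑ w ∈ Vᶜ, |g v * θ w v| :=
        (Finset.abs_sum_le_sum_abs _ _).trans
          (Finset.sum_le_sum fun v _ => Finset.abs_sum_le_sum_abs _ _)
    _ ≤ ∑ v ∈ V, ∑ w ∈ Vᶜ, M * (a v w * (g v - g w)) :=
        Finset.sum_le_sum fun v hv => Finset.sum_le_sum (hedge v hv)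
    _ = M * ∑ w ∈ Vᶜ, ∑ v ∈ V, a v w * (g v - g w) := by
        rw [Finset.sum_comm]
        simp only [Finset.mul_sum]
    _ ≤ M * ∑ w ∈ Vᶜ, networkLaplacian a g w := by
        gcongr with w hw
        exact hlaplacian w hw
    _ = M := by rw [hg.sum_compl_networkLaplacian hN.symm hz, mul_one]

theorem sum_sum_mul_deformedLog_le (hg : IsGreenFunction a V z g) (hsymm : ∀ v w, a v w = a w v)
    (ha : ∀ v w, 0 ≤ a v w) (hz : z ∈ V) {β : ℝ} (hβ : 0 < β) :
    ∑ v ∈ V, ∑ w ∈ V, a w v *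
      ((g w - g v) * (deformedLog β (1 + g w) - deformedLog β (1 + g v))) ≤ 2 / β := by
  have hpos : ∀ v, 0 < 1 + g v := fun v => by linarith [hg.nonneg v]
  have hnonneg : ∀ v w, 0 ≤ a w v *
      ((g w - g v) * (deformedLog β (1 + g w) - deformedLog β (1 + g v))) := fun v w => by
    have := sub_mul_deformedLog_sub_nonneg hβ (hpos v) (hpos w)
    rw [add_sub_add_left_eq_sub] at this
    exact mul_nonneg (ha w v) this
  calc _ ≤ ∑ v, ∑ w, a w v *
          ((g w - g v) * (deformedLog β (1 + g w) - deformedLog β (1 + g v))) :=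
        (Finset.sum_le_sum fun v _ => Finset.sum_le_sum_of_subset_of_nonneg
          (Finset.subset_univ _) fun w _ _ => hnonneg v w).trans
        (Finset.sum_le_sum_of_subset_of_nonneg (Finset.subset_univ _) fun v _ _ =>
          Finset.sum_nonneg fun w _ => hnonneg v w)
    _ = 2 * deformedLog β (1 + g z) := by
        rw [← hg.energy_comp_eq hsymm hz (φ := fun t => deformedLog β (1 + t)) (by simp)]
        simp only [mul_comm (g _ - g _)]
    _ ≤ 2 * (1 / β) := by
        gcongr
        exact deformedLog_le_one_div hβ (hpos z).le
    _ = 2 / β := by ring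

theorem abs_sum_interior_flow_le (hg : IsGreenFunction a V z g)
    (hN : IsBalancedNetwork a x V R) (hA : ∑ v ∈ V, speedMeasure a x v ≤ A) (hz : z ∈ V)
    {ε β k : ℝ} (hε : 0 < ε) (hβ : 0 < β) (hβ1 : β ≤ 1) (hk : 0 ≤ k) (hM : 0 ≤ M)
    (hr0 : ∀ v ∈ V, 0 ≤ r v) (hr : ∀ v ∈ V, r v ≤ k * ε * (1 + g v) ^ (-(β / 2)))
    (hθ : ∀ v ∈ V, ∀ w ∈ V, |θ w v| ≤ a w v * ‖x w - x v‖ * (M * max (r w) (r v))) :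
    |∑ v ∈ V, ∑ w ∈ V, (g v - g w) * θ w v| ≤
      M * (ε / 2 * (A + 2 * R ^ 2) + k ^ 2 * ε / 2 * (2 / β)) := by
  set ψ : ι → ℝ := fun v => deformedLog β (1 + g v)
  have hmin : ∀ u v w, g v ≤ g u ∨ g w ≤ g u →
      k * ε * (1 + g u) ^ (-(β / 2)) ≤ k * ε * min (1 + g v) (1 + g w) ^ (-(β / 2)) := by
    intro u v w h
    refine mul_le_mul_of_nonneg_left ?_ (by positivity)
    refine Real.rpow_le_rpow_of_nonpos ?_ (by simpa [min_le_iff] using h) (by linarith)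
    exact lt_min (by linarith [hg.nonneg v]) (by linarith [hg.nonneg w])
  have hedge : ∀ v ∈ V, ∀ w ∈ V, |(g v - g w) * θ w v| ≤
      M * (a w v * (ε / 2 * (‖x w - x v‖ ^ 2 * (1 + g v + g w)) +
        k ^ 2 * ε / 2 * ((g w - g v) * (ψ w - ψ v)))) := by
    intro v hv w hw
    have hmax : max (r w) (r v) ≤ k * ε * min (1 + g v) (1 + g w) ^ (-(β / 2)) :=
      max_le ((hr w hw).trans (hmin w v w (.inr le_rfl)))
        ((hr v hv).trans (hmin v v w (.inl le_rfl)))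
    have hyoung := mul_mul_abs_sub_le (D := ‖x w - x v‖) hε hβ hβ1
      (by linarith [hg.nonneg v]) (by linarith [hg.nonneg w])
      ((hr0 w hw).trans (le_max_left _ _)) hmax
    rw [add_sub_add_left_eq_sub, show 1 + g v + (1 + g w) - 1 = 1 + g v + g w by ring] at hyoung
    calc |(g v - g w) * θ w v|
        ≤ |g w - g v| * (a w v * ‖x w - x v‖ * (M * max (r w) (r v))) := by
          rw [abs_mul, abs_sub_comm]
          gcongr
          exact hθ v hv w hw
      _ = M * (a w v * (‖x w - x v‖ * max (r w) (r v) * |g w - g v|)) := by ring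
      _ ≤ _ := mul_le_mul_of_nonneg_left (mul_le_mul_of_nonneg_left hyoung (hN.nonneg w v)) hM
  calc |∑ v ∈ V, ∑ w ∈ V, (g v - g w) * θ w v| ≤ ∑ v ∈ V, ∑ w ∈ V, |(g v - g w) * θ w v| :=
        (Finset.abs_sum_le_sum_abs _ _).trans
          (Finset.sum_le_sum fun v _ => Finset.abs_sum_le_sum_abs _ _)
    _ ≤ ∑ v ∈ V, ∑ w ∈ V, M * (a w v * (ε / 2 * (‖x w - x v‖ ^ 2 * (1 + g v + g w)) +
          k ^ 2 * ε / 2 * ((g w - g v) * (ψ w - ψ v)))) :=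
        Finset.sum_le_sum fun v hv => Finset.sum_le_sum (hedge v hv)
    _ = M * (ε / 2 * ∑ v ∈ V, ∑ w ∈ V, a w v * (‖x w - x v‖ ^ 2 * (1 + g v + g w)) +
          k ^ 2 * ε / 2 * ∑ v ∈ V, ∑ w ∈ V, a w v * ((g w - g v) * (ψ w - ψ v))) := by
        simp only [Finset.mul_sum, ← Finset.sum_add_distrib]
        exact Finset.sum_congr rfl fun v _ => Finset.sum_congr rfl fun w _ => by ring
    _ ≤ _ := by
        gcongr
        · exact hg.sum_sum_mul_norm_sq_le hN hA hz
        · exact hg.sum_sum_mul_deformedLog_le hN.symm hN.nonneg hz hβ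

theorem le_mul_one_add_rpow (hg : IsGreenFunction a V z g) (hN : IsBalancedNetwork a x V R)
    (hA : ∑ v ∈ V, speedMeasure a x v ≤ A) (hz : z ∈ V) {F α : ℝ} (hF : 0 ≤ F) (hα : 0 ≤ α)
    {v : ι} (hv : v ∈ V) (hr : r v ≤ F * speedMeasure a x v ^ α) :
    r v ≤ F * (A + R ^ 2) ^ α * (1 + g v) ^ (-α) := by
  have hpos : 0 < 1 + g v := by linarith [hg.nonneg v]
  have hmass := hg.speedMeasure_mul_one_add_le hN hA hz hv
  have hspeed := speedMeasure_nonneg hN.nonneg x v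
  calc r v ≤ F * speedMeasure a x v ^ α := hr
    _ ≤ F * ((A + R ^ 2) / (1 + g v)) ^ α := by
      gcongr
      exact (le_div_iff₀ hpos).2 hmass
    _ = F * (A + R ^ 2) ^ α * (1 + g v) ^ (-α) := by
      rw [Real.div_rpow ((mul_nonneg hspeed hpos.le).trans hmass) hpos.le,
        Real.rpow_neg hpos.le]
      ring

end IsGreenFunction

/-- The constant in the sup bound for functions on a balanced network of total speed measure at
most `A` in a ball of radius `R`. -/
noncomputable def supBoundConstant (A R F α : ℝ) : ℝ :=
  A + 2 * R ^ 2 + (Real.exp 1 * max 1 (F * (A + R ^ 2) ^ α)) ^ 2 / α + 1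

theorem supBoundConstant_pos {A R F α : ℝ} (hA : 0 ≤ A) (hα : 0 < α) :
    0 < supBoundConstant A R F α := by
  unfold supBoundConstant
  positivity

omit [DecidableEq ι] in
theorem IsBalancedNetwork.abs_le_supBoundConstant_mul {F α L : ℝ}
    (hN : IsBalancedNetwork a x V R) (hA : ∑ v ∈ V, speedMeasure a x v ≤ A)
    (hF : 0 ≤ F) (hα : 0 < α) (hL : 1 ≤ L) (hLα : 2 * α ≤ L) (hM : 0 ≤ M)
    (hr0 : ∀ v ∈ V, 0 ≤ r v) (hrε : ∀ v ∈ V, r v ≤ Real.exp (-L))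
    (hrF : ∀ v ∈ V, r v ≤ F * speedMeasure a x v ^ α)
    (hf : ∀ v ∉ V, f v = 0) (hθf : ∀ v ∈ V, networkLaplacian a f v = ∑ w, θ w v)
    (hθ : ∀ v ∈ V, ∀ w ∈ V, θ w v = -θ v w)
    (hθV : ∀ v ∈ V, ∀ w ∈ V, |θ w v| ≤ a w v * ‖x w - x v‖ * (M * max (r w) (r v)))
    (hθB : ∀ v ∈ V, ∀ w ∉ V, |θ w v| ≤ a w v * (M * Real.exp (-L))) (hz : z ∈ V) :
    |f z| ≤ supBoundConstant A R F α * M * (Real.exp (-L) * L) := by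
  classical
  obtain ⟨g, hg⟩ := hN.exists_isGreenFunction z
  set ε := Real.exp (-L)
  set B := max 1 (F * (A + R ^ 2) ^ α)
  have hA0 : 0 ≤ A := (Finset.sum_nonneg fun v _ => speedMeasure_nonneg hN.nonneg x v).trans hA
  have hrg : ∀ v ∈ V, r v ≤ Real.exp 1 * B * ε * (1 + g v) ^ (-(2 * α / L / 2)) := by
    intro v hv
    have hpos : 0 < 1 + g v := by linarith [hg.nonneg v]
    rw [show 2 * α / L / 2 = α / L by ring]
    refine le_mul_rpow_of_le_exp_of_le hL (hr0 v hv) (hrε v hv) (le_max_left _ _) hpos ?_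
    refine (hg.le_mul_one_add_rpow hN hA hz hF hα.le hv (hrF v hv)).trans ?_
    gcongr
    exact le_max_right _ _
  have hinterior := hg.abs_sum_interior_flow_le hN hA hz (Real.exp_pos (-L)) (by positivity)
    ((div_le_one (by linarith)).2 hLα) (by positivity) hM hr0 hrg hθV
  have hboundary := hg.abs_sum_boundary_flow_le hN hz (by positivity) hθB
  have hMε : 0 ≤ M * ε := by positivity
  calc |f z| ≤ (1 / 2) * (M * (ε / 2 * (A + 2 * R ^ 2) +
          (Real.exp 1 * B) ^ 2 * ε / 2 * (2 / (2 * α / L)))) + M * ε := by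
        rw [← abs_neg, hg.neg_eq_sum_mul_flow hN.symm hz hf hθf hθ]
        refine (abs_add_le _ _).trans (add_le_add ?_ hboundary)
        rw [abs_mul, abs_of_pos one_half_pos]
        gcongr
    _ = M * ε * (A + 2 * R ^ 2) / 4 + M * ε * ((Real.exp 1 * B) ^ 2 * (L / α)) / 4 + M * ε := by
        field_simp
        ring
    _ ≤ M * ε * (A + 2 * R ^ 2) * L + M * ε * ((Real.exp 1 * B) ^ 2 * (L / α)) + M * ε * L := by
        have hmass : 0 ≤ M * ε * (A + 2 * R ^ 2) := by positivity
        have henergy : 0 ≤ M * ε * ((Real.exp 1 * B) ^ 2 * (L / α)) := by positivity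
        linarith [le_mul_of_one_le_right hmass hL, le_mul_of_one_le_right hMε hL]
    _ = supBoundConstant A R F α * M * (ε * L) := by
        rw [supBoundConstant]
        ring

end SupBound

section Hyperplane

theorem volume_setOf_linearMap_eq {E : Type*} [NormedAddCommGroup E]
    [InnerProductSpace ℝ E] [FiniteDimensional ℝ E] [MeasurableSpace E] [BorelSpace E]
    {l : E →ₗ[ℝ] ℝ} (hl : l ≠ 0) (c : ℝ) : volume {x | l x = c} = 0 := by
  let s : AffineSubspace ℝ E := (AffineSubspace.mk' c ⊥).comap l.toAffineMap
  have hs : {x | l x = c} = s := by ext x; simp [s, sub_eq_zero]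
  rw [hs]
  refine Measure.addHaar_affineSubspace volume s fun htop => hl ?_
  have hconst (x : E) : l x = c := by
    have hx : x ∈ {x | l x = c} := by rw [hs, htop]; trivial
    exact hx
  ext x
  rw [hconst x, ← hconst 0, map_zero, LinearMap.zero_apply]

variable {E : Type*} [NormedAddCommGroup E] [InnerProductSpace ℝ E] {k : ℕ}
  [Fact (Module.finrank ℝ E = k + 1)] {n : E}

variable (k) in
/-- Orthonormal coordinates `(y, z)` on a Euclidean space adapted to a unit vector `n`: the
hyperplanes orthogonal to `n` are the slices on which `z` is constant. -/
noncomputable def hyperplaneCoordinates (hn : ‖n‖ = 1) : (EuclideanSpace ℝ (Fin k) × ℝ) ≃L[ℝ] E :=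
  (((ContinuousLinearEquiv.prodComm ℝ (EuclideanSpace ℝ (Fin k)) ℝ).trans
    ((LinearIsometryEquiv.toSpanUnitSingleton n hn).toContinuousLinearEquiv.prodCongr
      (OrthonormalBasis.fromOrthogonalSpanSingleton k
        (norm_ne_zero_iff.1 (hn ▸ one_ne_zero))).repr.symm.toContinuousLinearEquiv)).trans
    (WithLp.prodContinuousLinearEquiv 2 ℝ (ℝ ∙ n) (ℝ ∙ n)ᗮ).symm).trans
    (Submodule.orthogonalDecomposition (ℝ ∙ n)).symm.toContinuousLinearEquiv

theorem hyperplaneCoordinates_apply (hn : ‖n‖ = 1) (y : EuclideanSpace ℝ (Fin k)) (z : ℝ) :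
    hyperplaneCoordinates k hn (y, z) = z • n +
      (OrthonormalBasis.fromOrthogonalSpanSingleton k
        (norm_ne_zero_iff.1 (hn ▸ one_ne_zero : ‖n‖ ≠ 0))).repr.symm y := by
  simp [hyperplaneCoordinates]

theorem hyperplaneCoordinates_eq_add_smul (hn : ‖n‖ = 1) (y : EuclideanSpace ℝ (Fin k)) (z c : ℝ) :
    hyperplaneCoordinates k hn (y, z) = hyperplaneCoordinates k hn (y, c) + (z - c) • n := by
  simp only [hyperplaneCoordinates_apply]
  module

theorem inner_hyperplaneCoordinates (hn : ‖n‖ = 1) (p : EuclideanSpace ℝ (Fin k) × ℝ) :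
    ⟪n, hyperplaneCoordinates k hn p⟫_ℝ = p.2 := by
  have hself : ⟪n, n⟫_ℝ = 1 := by rw [real_inner_self_eq_norm_sq, hn, one_pow]
  rw [← p.eta, hyperplaneCoordinates_apply, inner_add_right, inner_smul_right, hself,
    Submodule.mem_orthogonal_singleton_iff_inner_right.1 (Subtype.prop _), mul_one, add_zero]

theorem norm_hyperplaneCoordinates_zero (hn : ‖n‖ = 1) (y : EuclideanSpace ℝ (Fin k)) :
    ‖hyperplaneCoordinates k hn (y, 0)‖ = ‖y‖ := by
  rw [hyperplaneCoordinates_apply, zero_smul, zero_add, ← Submodule.coe_norm,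
    LinearIsometryEquiv.norm_map]

theorem norm_fst_le_norm_hyperplaneCoordinates (hn : ‖n‖ = 1) (p : EuclideanSpace ℝ (Fin k) × ℝ) :
    ‖p.1‖ ≤ ‖hyperplaneCoordinates k hn p‖ := by
  have h0 : ⟪hyperplaneCoordinates k hn (p.1, 0), p.2 • n⟫_ℝ = 0 := by
    rw [inner_smul_right, real_inner_comm, inner_hyperplaneCoordinates, mul_zero]
  have hsq : ‖hyperplaneCoordinates k hn p‖ ^ 2 = ‖p.1‖ ^ 2 + p.2 ^ 2 := by
    rw [← p.eta, hyperplaneCoordinates_eq_add_smul hn _ _ 0, sub_zero, norm_add_sq_real, h0,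
      norm_smul, hn, norm_hyperplaneCoordinates_zero]
    simp
  refine le_of_sq_le_sq ?_ (norm_nonneg _)
  rw [hsq]
  exact le_add_of_nonneg_right (sq_nonneg _)

theorem isometry_hyperplaneCoordinates (hn : ‖n‖ = 1) (c : ℝ) :
    Isometry fun y => hyperplaneCoordinates k hn (y, c) := by
  refine Isometry.of_dist_eq fun y y' => ?_
  rw [dist_eq_norm, dist_eq_norm, ← map_sub, Prod.mk_sub_mk, sub_self,
    norm_hyperplaneCoordinates_zero]

theorem range_hyperplaneCoordinates (hn : ‖n‖ = 1) (c : ℝ) :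
    (range fun y => hyperplaneCoordinates k hn (y, c)) = {x | ⟪n, x⟫_ℝ = c} := by
  ext x
  constructor
  · rintro ⟨y, rfl⟩
    exact inner_hyperplaneCoordinates hn _
  · obtain ⟨p, rfl⟩ := (hyperplaneCoordinates k hn).surjective x
    rintro rfl
    exact ⟨p.1, by rw [inner_hyperplaneCoordinates]⟩

variable [MeasurableSpace E] [BorelSpace E]

theorem euclideanHausdorffMeasure_eq_volume_preimage (hn : ‖n‖ = 1) {c : ℝ} {S : Set E}
    (hS : ∀ x ∈ S, ⟪n, x⟫_ℝ = c) :
    μHE[k] S = volume ((fun y => hyperplaneCoordinates k hn (y, c)) ⁻¹' S) := by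
  rw [← EuclideanSpace.euclideanHausdorffMeasure_eq_volume,
    (isometry_hyperplaneCoordinates hn c).euclideanHausdorffMeasure_preimage,
    range_hyperplaneCoordinates, inter_eq_self_of_subset_left (t := {x | ⟪n, x⟫_ℝ = c}) hS]

theorem setIntegral_euclideanHausdorffMeasure_eq (hn : ‖n‖ = 1) {c : ℝ} {S : Set E}
    (hS : ∀ x ∈ S, ⟪n, x⟫_ℝ = c) (φ : E → ℝ) :
    ∫ x in S, φ x ∂μHE[k] =
      ∫ y in (fun y => hyperplaneCoordinates k hn (y, c)) ⁻¹' S,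
        φ (hyperplaneCoordinates k hn (y, c)) := by
  have hiso := isometry_hyperplaneCoordinates (k := k) hn c
  rw [← EuclideanSpace.euclideanHausdorffMeasure_eq_volume,
    ← hiso.isClosedEmbedding.measurableEmbedding.setIntegral_map,
    hiso.map_euclideanHausdorffMeasure, range_hyperplaneCoordinates,
    Measure.restrict_restrict_of_subset (t := {x | ⟪n, x⟫_ℝ = c}) hS]

theorem euclideanHausdorffMeasure_ne_top_of_isCompact (hn : ‖n‖ = 1) {c : ℝ} {S : Set E}
    (hS : ∀ x ∈ S, ⟪n, x⟫_ℝ = c) (hScomp : IsCompact S) : μHE[k] S ≠ ⊤ := by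
  rw [euclideanHausdorffMeasure_eq_volume_preimage hn hS]
  exact ((isometry_hyperplaneCoordinates hn c).isClosedEmbedding.isCompact_preimage
    hScomp).measure_ne_top

theorem euclideanHausdorffMeasure_hyperplane_inter_eq_zero (hn : ‖n‖ = 1) {c c' : ℝ} {n' p : E}
    (hp : ⟪n, p⟫_ℝ = c) (hp' : ⟪n', p⟫_ℝ ≠ c') :
    μHE[k] {x | ⟪n, x⟫_ℝ = c ∧ ⟪n', x⟫_ℝ = c'} = 0 := by
  rw [euclideanHausdorffMeasure_eq_volume_preimage hn (c := c) fun x hx => hx.1]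
  let Φ : (EuclideanSpace ℝ (Fin k) × ℝ) ≃L[ℝ] E := hyperplaneCoordinates k hn
  let l : EuclideanSpace ℝ (Fin k) →ₗ[ℝ] ℝ :=
    (innerₛₗ ℝ n').comp (Φ.toLinearMap.comp (LinearMap.inl ℝ _ ℝ))
  have hl (y y' : EuclideanSpace ℝ (Fin k)) :
      ⟪n', Φ (y, c)⟫_ℝ = ⟪n', Φ (y', c)⟫_ℝ + l (y - y') := by
    simp [l, ← inner_add_right, ← map_add]
  obtain ⟨y₀, rfl⟩ : p ∈ range fun y => Φ (y, c) := by rwa [range_hyperplaneCoordinates]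
  rcases eq_or_ne l 0 with hl0 | hl0
  · refine measure_mono_null (fun y hy => hp' ?_) measure_empty
    rw [hl y₀ y, hl0, LinearMap.zero_apply, add_zero]
    exact hy.2
  · refine measure_mono_null (fun y hy => ?_)
      (volume_setOf_linearMap_eq hl0 (c' - ⟪n', Φ (0, c)⟫_ℝ))
    have := hl y 0
    rw [sub_zero] at this
    exact eq_sub_of_add_eq' (this.symm.trans hy.2)

theorem euclideanHausdorffMeasure_eq_zero_of_finrank_ne (hn : ‖n‖ = 1) {c : ℝ} {S : Set E}
    (hS : ∀ x ∈ S, ⟪n, x⟫_ℝ = c)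
    (hrank : S.Nonempty → Module.finrank ℝ (affineSpan ℝ S).direction ≠ k) : μHE[k] S = 0 := by
  rcases S.eq_empty_or_nonempty with rfl | hne
  · simp
  rw [euclideanHausdorffMeasure_eq_volume_preimage hn hS]
  let Φ : (EuclideanSpace ℝ (Fin k) × ℝ) ≃L[ℝ] E := hyperplaneCoordinates k hn
  let f : EuclideanSpace ℝ (Fin k) →ᵃ[ℝ] E :=
    Φ.toLinearMap.toAffineMap.comp ((AffineMap.id ℝ _).prod (AffineMap.const ℝ _ c))
  have hf : Function.Injective f := (isometry_hyperplaneCoordinates hn c).injective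
  refine measure_mono_null (t := ((affineSpan ℝ S).comap f : Set _))
    (fun y hy => subset_affineSpan ℝ S hy)
    (Measure.addHaar_affineSubspace _ _ fun htop => hrank hne ?_)
  have hspan : affineSpan ℝ S = AffineSubspace.map f ⊤ := by
    apply le_antisymm
    · rw [affineSpan_le]
      intro x hx
      obtain ⟨y, rfl⟩ : x ∈ range f := by
        rw [show range f = _ from range_hyperplaneCoordinates hn c]; exact hS x hx
      exact ⟨y, trivial, rfl⟩
    · rw [AffineSubspace.map_le_iff_le_comap, htop]
  rw [hspan, AffineSubspace.map_direction, AffineSubspace.direction_top, Submodule.map_top,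
    LinearMap.finrank_range_of_inj (f.linear_injective_iff.2 hf), finrank_euclideanSpace_fin]

theorem measurePreserving_hyperplaneCoordinates [FiniteDimensional ℝ E] (hn : ‖n‖ = 1) :
    MeasurePreserving (hyperplaneCoordinates k hn) := by
  have hprod := (LinearIsometryEquiv.toSpanUnitSingleton n hn).measurePreserving.prod
    (OrthonormalBasis.fromOrthogonalSpanSingleton k
      (norm_ne_zero_iff.1 (hn ▸ one_ne_zero : ‖n‖ ≠ 0))).repr.symm.measurePreserving
  exact (Submodule.orthogonalDecomposition (ℝ ∙ n)).symm.measurePreserving.comp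
    ((WithLp.volume_preserving_toLp (ℝ ∙ n) (ℝ ∙ n)ᗮ).comp
      (hprod.comp Measure.measurePreserving_swap))

end Hyperplane

section Cone

theorem isCompact_convexJoin {E : Type*} [NormedAddCommGroup E] [NormedSpace ℝ E] {S T : Set E}
    (hS : IsCompact S) (hT : IsCompact T) : IsCompact (convexJoin ℝ S T) := by
  have himage : convexJoin ℝ S T =
      (fun q : ℝ × E × E => q.2.1 + q.1 • (q.2.2 - q.2.1)) '' (Icc (0 : ℝ) 1 ×ˢ S ×ˢ T) := by
    ext x
    simp only [mem_convexJoin, segment_eq_image', mem_image, mem_prod, Prod.exists]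
    constructor
    · rintro ⟨a, ha, b, hb, t, ht, rfl⟩
      exact ⟨t, a, b, ⟨ht, ha, hb⟩, rfl⟩
    · rintro ⟨t, a, b, ⟨ht, ha, hb⟩, rfl⟩
      exact ⟨a, ha, b, hb, t, ht, rfl⟩
  rw [himage]
  exact (isCompact_Icc.prod (hS.prod hT)).image (by fun_prop)

theorem isCompact_convexHull_insert {E : Type*} [NormedAddCommGroup E] [NormedSpace ℝ E]
    {S : Set E} (hS : IsCompact S) (hSc : Convex ℝ S) (p : E) :
    IsCompact (convexHull ℝ (insert p S)) := by
  rcases S.eq_empty_or_nonempty with rfl | hne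
  · simp
  · rw [convexHull_insert hne, hSc.convexHull_eq]
    exact isCompact_convexJoin isCompact_singleton hS

theorem mem_convexHull_insert_iff {E : Type*} [AddCommGroup E] [Module ℝ E] {S : Set E}
    (hSc : Convex ℝ S) (hne : S.Nonempty) {p x : E} :
    x ∈ convexHull ℝ (insert p S) ↔
      ∃ t ∈ Icc (0 : ℝ) 1, x ∈ AffineMap.homothety p t '' S := by
  simp only [convexHull_insert hne, hSc.convexHull_eq, mem_convexJoin, mem_singleton_iff,
    exists_eq_left, segment_eq_image_lineMap, mem_image, AffineMap.homothety_eq_lineMap]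
  grind

variable {E : Type*} [NormedAddCommGroup E] [InnerProductSpace ℝ E] {S : Set E} {p a : E}

theorem homothety_mem_mk'_orthogonal_iff (ha : a ≠ 0) {s : E} (has : ⟪a, s - p⟫_ℝ = ‖a‖ ^ 2)
    {r t : ℝ} :
    AffineMap.homothety p r s ∈ AffineSubspace.mk' (t • a +ᵥ p) (ℝ ∙ a)ᗮ ↔ r = t := by
  have hsub : AffineMap.homothety p r s -ᵥ (t • a +ᵥ p) = r • (s - p) - t • a := by
    simp [AffineMap.homothety_apply]
  have ha2 : ‖a‖ ^ 2 ≠ 0 := pow_ne_zero 2 (norm_ne_zero_iff.2 ha)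
  rw [AffineSubspace.mem_mk', hsub, Submodule.mem_orthogonal_singleton_iff_inner_right,
    inner_sub_right, inner_smul_right, inner_smul_right, has, real_inner_self_eq_norm_sq,
    ← sub_mul, mul_eq_zero_iff_right ha2, sub_eq_zero]

theorem convexHull_insert_inter_orthogonal (ha : a ≠ 0) (hSc : Convex ℝ S) (hne : S.Nonempty)
    (haS : ∀ s ∈ S, ⟪a, s - p⟫_ℝ = ‖a‖ ^ 2) {t : ℝ} (ht : t ∈ Icc (0 : ℝ) 1) :
    convexHull ℝ (insert p S) ∩ AffineSubspace.mk' (t • a +ᵥ p) (ℝ ∙ a)ᗮ =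
      AffineMap.homothety p t '' S := by
  ext x
  rw [mem_inter_iff, mem_convexHull_insert_iff hSc hne]
  constructor
  · rintro ⟨⟨r, -, s, hs, rfl⟩, hx⟩
    exact ⟨s, hs, by rw [(homothety_mem_mk'_orthogonal_iff ha (haS s hs)).1 hx]⟩
  · rintro ⟨s, hs, rfl⟩
    exact ⟨⟨t, ht, s, hs, rfl⟩, (homothety_mem_mk'_orthogonal_iff ha (haS s hs)).2 rfl⟩

theorem convexHull_insert_inter_orthogonal_eq_empty (ha : a ≠ 0) (hSc : Convex ℝ S)
    (hne : S.Nonempty) (haS : ∀ s ∈ S, ⟪a, s - p⟫_ℝ = ‖a‖ ^ 2) {t : ℝ} (ht : t ∉ Icc (0 : ℝ) 1) :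
    convexHull ℝ (insert p S) ∩ AffineSubspace.mk' (t • a +ᵥ p) (ℝ ∙ a)ᗮ = ∅ := by
  refine eq_empty_of_forall_notMem fun x ⟨hx, hxt⟩ => ?_
  obtain ⟨r, hr, s, hs, rfl⟩ := (mem_convexHull_insert_iff hSc hne).1 hx
  exact ht ((homothety_mem_mk'_orthogonal_iff ha (haS s hs)).1 hxt ▸ hr)

theorem lintegral_Ioc_ofReal_pow (m : ℕ) :
    ∫⁻ t in Ioc (0 : ℝ) 1, ENNReal.ofReal (t ^ m) = ENNReal.ofReal (1 / (m + 1)) := by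
  rw [← ofReal_integral_eq_lintegral_ofReal, ← intervalIntegral.integral_of_le zero_le_one,
    integral_pow]
  · simp
  · exact (continuous_pow m).integrableOn_Ioc
  · filter_upwards [ae_restrict_mem measurableSet_Ioc] with t ht
    exact pow_nonneg ht.1.le m

variable [FiniteDimensional ℝ E] [MeasurableSpace E] [BorelSpace E]

theorem volume_convexHull_insert (ha : a ≠ 0) (hSc : Convex ℝ S) (hScomp : IsCompact S)
    (hne : S.Nonempty) (haS : ∀ s ∈ S, ⟪a, s - p⟫_ℝ = ‖a‖ ^ 2) :
    volume (convexHull ℝ (insert p S)) =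
      ENNReal.ofReal (‖a‖ / Module.finrank ℝ E) * μHE[Module.finrank ℝ E - 1] S := by
  set m := Module.finrank ℝ E - 1 with hm
  have hrank : (Module.finrank ℝ E : ℝ) = m + 1 := by
    have : Nontrivial E := ⟨a, 0, ha⟩
    rw [hm, Nat.cast_sub Module.finrank_pos, Nat.cast_one, sub_add_cancel]
  have hslice : ∀ᵐ t : ℝ, μHE[m]
      (convexHull ℝ (insert p S) ∩ AffineSubspace.mk' (t • a +ᵥ p) (ℝ ∙ a)ᗮ) =
        (Ioc (0 : ℝ) 1).indicator (fun t => ENNReal.ofReal (t ^ m) * μHE[m] S) t := by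
    filter_upwards [compl_mem_ae_iff.2 (measure_singleton (0 : ℝ))] with t (ht0 : t ≠ 0)
    by_cases ht : t ∈ Ioc (0 : ℝ) 1
    · rw [indicator_of_mem ht, convexHull_insert_inter_orthogonal ha hSc hne haS ⟨ht.1.le, ht.2⟩,
        euclideanHausdorffMeasure_homothety_image m p ht0, ENNReal.smul_def, smul_eq_mul]
      congr 1
      rw [ENNReal.ofReal_pow ht.1.le, ENNReal.coe_pow, ← enorm_eq_nnnorm,
        Real.enorm_of_nonneg ht.1.le]
    · have htIcc : t ∉ Icc (0 : ℝ) 1 := fun h => ht ⟨h.1.lt_of_ne' ht0, h.2⟩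
      rw [indicator_of_notMem ht, convexHull_insert_inter_orthogonal_eq_empty ha hSc hne haS htIcc,
        measure_empty]
  have hmeas : MeasurableSet (convexHull ℝ (insert p S)) :=
    (isCompact_convexHull_insert hScomp hSc p).measurableSet
  rw [← InnerProductSpace.euclideanHausdorffMeasure_eq_volume,
    EuclideanGeometry.euclideanHausdorffMeasure_eq_lintegral p ha hmeas, lintegral_congr_ae hslice,
    lintegral_indicator measurableSet_Ioc, lintegral_mul_const _ (by fun_prop),
    lintegral_Ioc_ofReal_pow, ← mul_assoc, ← ofReal_norm,
    ← ENNReal.ofReal_mul (norm_nonneg a), mul_one_div, hrank]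

end Cone

section SmoothTransition

open Filter Topology Real

theorem deriv_smoothTransition_eq_zero {t : ℝ} (ht : t ∉ Icc (0 : ℝ) 1) :
    deriv smoothTransition t = 0 := by
  rcases not_and_or.1 ht with ht | ht
  · have heq : smoothTransition =ᶠ[𝓝 t] fun _ => 0 := by
      filter_upwards [Iio_mem_nhds (not_le.1 ht)] with x hx
      exact smoothTransition.zero_of_nonpos (le_of_lt hx)
    rw [heq.deriv_eq, deriv_const]
  · have heq : smoothTransition =ᶠ[𝓝 t] fun _ => 1 := by
      filter_upwards [Ioi_mem_nhds (not_le.1 ht)] with x hx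
      exact smoothTransition.one_of_one_le (le_of_lt hx)
    rw [heq.deriv_eq, deriv_const]

theorem continuous_deriv_smoothTransition : Continuous (deriv smoothTransition) :=
  (smoothTransition.contDiff (n := 1)).continuous_deriv le_rfl

theorem integrable_deriv_smoothTransition : Integrable (deriv smoothTransition) :=
  continuous_deriv_smoothTransition.integrable_of_hasCompactSupport
    (HasCompactSupport.intro isCompact_Icc fun _ => deriv_smoothTransition_eq_zero)

theorem integral_deriv_smoothTransition : ∫ t, deriv smoothTransition t = 1 := by
  have hIcc : ∫ t in Icc (0 : ℝ) 1, deriv smoothTransition t = ∫ t, deriv smoothTransition t :=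
    setIntegral_eq_integral_of_forall_compl_eq_zero fun t ht => deriv_smoothTransition_eq_zero ht
  rw [← hIcc, integral_Icc_eq_integral_Ioc, ← intervalIntegral.integral_of_le zero_le_one,
    intervalIntegral.integral_deriv_eq_sub]
  · simp
  · exact fun x _ => (smoothTransition.contDiffAt (n := 1)).differentiableAt one_ne_zero
  · exact continuous_deriv_smoothTransition.intervalIntegrable _ _

theorem tendsto_smoothTransition_add_div {a : ℝ} (ha : a ≠ 0) (b : ℝ) :
    Tendsto (fun s => smoothTransition (a / s + b)) (𝓝[>] 0) (𝓝 (if 0 < a then 1 else 0)) := by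
  have hinv : Tendsto (fun s : ℝ => s⁻¹) (𝓝[>] 0) atTop := tendsto_inv_nhdsGT_zero
  refine tendsto_const_nhds.congr' ?_
  rcases ha.lt_or_gt with ha | ha
  · have hbot : Tendsto (fun s : ℝ => a / s + b) (𝓝[>] 0) atBot :=
      tendsto_atBot_add_const_right _ _ (hinv.const_mul_atTop_of_neg ha)
    filter_upwards [hbot.eventually_le_atBot 0] with s hs
    rw [if_neg ha.not_gt, smoothTransition.zero_of_nonpos hs]
  · have htop : Tendsto (fun s : ℝ => a / s + b) (𝓝[>] 0) atTop :=
      tendsto_atTop_add_const_right _ _ (hinv.const_mul_atTop ha)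
    filter_upwards [htop.eventually_ge_atTop 1] with s hs
    rw [if_pos ha, smoothTransition.one_of_one_le hs]

end SmoothTransition

section Divergence

open Filter Topology Real

variable {E : Type*} [NormedAddCommGroup E] [InnerProductSpace ℝ E]

/-- The polytope cut out by finitely many half-spaces `⟪n, x⟫ ≤ c`, given as pairs `(n, c)`. -/
def polytope (I : Finset (E × ℝ)) : Set E := {x | ∀ i ∈ I, ⟪i.1, x⟫_ℝ ≤ i.2}

/-- A smooth approximation of the indicator of `polytope I`: it vanishes outside of the polytope
and equals `1` at distance at least `s` from all the bounding hyperplanes. -/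
noncomputable def polytopeCutoff (I : Finset (E × ℝ)) (s : ℝ) (x : E) : ℝ :=
  ∏ i ∈ I, smoothTransition ((i.2 - ⟪i.1, x⟫_ℝ) / s)

/-- The density which, up to sign, is the normal derivative of the cutoff of a half-space. As
`s → 0` it concentrates to the surface measure of the bounding hyperplane. -/
noncomputable def layerDensity (i : E × ℝ) (s : ℝ) (x : E) : ℝ :=
  s⁻¹ * deriv smoothTransition ((i.2 - ⟪i.1, x⟫_ℝ) / s)

theorem isClosed_polytope (I : Finset (E × ℝ)) : IsClosed (polytope I) := by
  simp only [polytope, ofPred_forall]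
  exact isClosed_biInter fun i _ => isClosed_le (by fun_prop) continuous_const

theorem continuous_polytopeCutoff (I : Finset (E × ℝ)) (s : ℝ) : Continuous (polytopeCutoff I s) :=
  continuous_finsetProd _ fun _ _ => smoothTransition.continuous.comp (by fun_prop)

theorem continuous_layerDensity (i : E × ℝ) (s : ℝ) : Continuous (layerDensity i s) :=
  continuous_const.mul (continuous_deriv_smoothTransition.comp (by fun_prop))

theorem abs_polytopeCutoff_le_one (I : Finset (E × ℝ)) (s : ℝ) (x : E) :
    |polytopeCutoff I s x| ≤ 1 := by
  rw [polytopeCutoff, Finset.abs_prod]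
  refine Finset.prod_le_one (fun _ _ => abs_nonneg _) fun _ _ => ?_
  rw [abs_of_nonneg (smoothTransition.nonneg _)]
  exact smoothTransition.le_one _

theorem hasFDerivAt_polytopeCutoff [DecidableEq E] (I : Finset (E × ℝ)) (s : ℝ) (x : E) :
    HasFDerivAt (polytopeCutoff I s)
      (-∑ i ∈ I, (layerDensity i s x * polytopeCutoff (I.erase i) s x) • innerSL ℝ i.1) x := by
  have hfactor (i : E × ℝ) : HasFDerivAt (fun x => smoothTransition ((i.2 - ⟪i.1, x⟫_ℝ) / s))
      (-(layerDensity i s x • innerSL ℝ i.1)) x := by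
    have houter : HasDerivAt smoothTransition _ ((i.2 - ⟪i.1, x⟫_ℝ) / s) :=
      ((smoothTransition.contDiffAt (n := 1)).differentiableAt one_ne_zero).hasDerivAt
    have hinner : HasFDerivAt (fun x => (i.2 - ⟪i.1, x⟫_ℝ) / s) (s⁻¹ • -innerSL ℝ i.1) x := by
      simpa [div_eq_mul_inv] using
        (((innerSL ℝ i.1).hasFDerivAt (x := x)).const_sub i.2).mul_const s⁻¹
    refine (houter.comp_hasFDerivAt x hinner).congr_fderiv ?_
    simp only [layerDensity]
    module
  refine (HasFDerivAt.finsetProd fun i (_ : i ∈ I) => hfactor i).congr_fderiv ?_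
  rw [← Finset.sum_neg_distrib]
  refine Finset.sum_congr rfl fun i _ => ?_
  simp only [polytopeCutoff]
  module

theorem tendsto_polytopeCutoff {I : Finset (E × ℝ)} {x : E} (hx : ∀ i ∈ I, ⟪i.1, x⟫_ℝ ≠ i.2)
    (w : E) : Tendsto (fun s => polytopeCutoff I s (x - s • w)) (𝓝[>] 0)
      (𝓝 ((polytope I).indicator 1 x)) := by
  have hprod : Tendsto (fun s => polytopeCutoff I s (x - s • w)) (𝓝[>] 0)
      (𝓝 (∏ i ∈ I, if 0 < i.2 - ⟪i.1, x⟫_ℝ then 1 else 0)) := by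
    refine tendsto_finsetProd _ fun i hi => ?_
    refine (tendsto_smoothTransition_add_div (sub_ne_zero.2 (hx i hi).symm) ⟪i.1, w⟫_ℝ).congr' ?_
    filter_upwards [self_mem_nhdsWithin] with s (hs : 0 < s)
    congr 1
    rw [inner_sub_right, inner_smul_right]
    field_simp
    ring
  convert hprod using 2
  by_cases hxI : x ∈ polytope I
  · rw [indicator_of_mem hxI, Pi.one_apply, Finset.prod_eq_one]
    exact fun i hi => if_pos (sub_pos.2 (lt_of_le_of_ne (hxI i hi) (hx i hi)))
  · obtain ⟨i, hi, hxi⟩ : ∃ i ∈ I, i.2 < ⟪i.1, x⟫_ℝ := by simpa [polytope] using hxI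
    rw [indicator_of_notMem hxI, Finset.prod_eq_zero hi]
    exact if_neg (by linarith)

variable [FiniteDimensional ℝ E] [MeasurableSpace E] [BorelSpace E]

theorem integral_fderiv_mul_polytopeCutoff [DecidableEq E] {φ : E → ℝ} (hφ : ContDiff ℝ 1 φ)
    (hφc : HasCompactSupport φ) (I : Finset (E × ℝ)) (s : ℝ) (u : E) :
    ∫ x, fderiv ℝ φ x u * polytopeCutoff I s x =
      ∑ i ∈ I, ⟪i.1, u⟫_ℝ *
        ∫ x, φ x * polytopeCutoff (I.erase i) s x * layerDensity i s x := by
  have hfderiv (x : E) : φ x * fderiv ℝ (polytopeCutoff I s) x u =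
      -∑ i ∈ I, ⟪i.1, u⟫_ℝ * (φ x * polytopeCutoff (I.erase i) s x * layerDensity i s x) := by
    rw [(hasFDerivAt_polytopeCutoff I s x).fderiv, neg_apply, sum_apply, mul_neg, Finset.mul_sum]
    refine congrArg _ (Finset.sum_congr rfl fun i _ => ?_)
    rw [smul_apply, innerSL_apply_apply, smul_eq_mul]
    ring
  have hInt (i : E × ℝ) : Integrable fun x =>
      φ x * polytopeCutoff (I.erase i) s x * layerDensity i s x :=
    ((hφ.continuous.mul (continuous_polytopeCutoff _ s)).mul
      (continuous_layerDensity i s)).integrable_of_hasCompactSupport hφc.mul_right.mul_right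
  have hφu : Continuous fun x => fderiv ℝ φ x u :=
    (hφ.continuous_fderiv one_ne_zero).clm_apply continuous_const
  have hparts := integral_mul_fderiv_eq_neg_fderiv_mul_of_integrable (μ := volume) (f := φ)
    (g := polytopeCutoff I s) (v := u)
    ((hφu.mul (continuous_polytopeCutoff I s)).integrable_of_hasCompactSupport
      (hφc.fderiv_apply (𝕜 := ℝ) u).mul_right)
    (by
      simp only [hfderiv]
      exact (integrable_finsetSum _ fun i _ => (hInt i).const_mul _).neg)
    ((hφ.continuous.mul (continuous_polytopeCutoff I s)).integrable_of_hasCompactSupport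
      hφc.mul_right)
    (fun x _ => hφ.differentiable one_ne_zero x)
    (fun x _ => (hasFDerivAt_polytopeCutoff I s x).differentiableAt)
  simp only [hfderiv] at hparts
  rw [integral_neg, neg_inj, integral_finsetSum _ fun i _ => (hInt i).const_mul _] at hparts
  rw [← hparts]
  exact Finset.sum_congr rfl fun i _ => integral_const_mul _ _

theorem ae_inner_ne {n : E} (hn : n ≠ 0) (c : ℝ) : ∀ᵐ x : E, ⟪n, x⟫_ℝ ≠ c := by
  have hl : innerₛₗ ℝ n ≠ 0 := fun h => hn (inner_self_eq_zero.1 (LinearMap.congr_fun h n))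
  rw [ae_iff]
  simpa using volume_setOf_linearMap_eq hl c

theorem tendsto_integral_mul_polytopeCutoff {I : Finset (E × ℝ)} (hI : ∀ i ∈ I, i.1 ≠ 0)
    {f : E → ℝ} (hf : Integrable f) :
    Tendsto (fun s => ∫ x, f x * polytopeCutoff I s x) (𝓝[>] 0) (𝓝 (∫ x in polytope I, f x)) := by
  have hoff : ∀ᵐ x : E, ∀ i ∈ I, ⟪i.1, x⟫_ℝ ≠ i.2 :=
    (Finset.eventually_all I).2 fun i hi => ae_inner_ne (hI i hi) i.2
  rw [← integral_indicator (isClosed_polytope I).measurableSet]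
  refine tendsto_integral_filter_of_dominated_convergence (fun x => |f x|) ?_ ?_ hf.abs ?_
  · exact .of_forall fun s =>
      hf.aestronglyMeasurable.mul (continuous_polytopeCutoff I s).aestronglyMeasurable
  · refine .of_forall fun s => .of_forall fun x => ?_
    rw [norm_mul, Real.norm_eq_abs, Real.norm_eq_abs]
    exact mul_le_of_le_one_right (abs_nonneg _) (abs_polytopeCutoff_le_one I s x)
  · filter_upwards [hoff] with x hx
    have hlim := (tendsto_polytopeCutoff hx 0).const_mul (f x)
    simp only [smul_zero, sub_zero] at hlim
    convert hlim using 2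
    by_cases hxI : x ∈ polytope I <;> simp [hxI]

variable {k : ℕ} [Fact (Module.finrank ℝ E = k + 1)]

theorem integral_mul_layerDensity {n : E} (hn : ‖n‖ = 1) (c : ℝ) {s : ℝ} (hs : 0 < s)
    (ψ : E → ℝ) : ∫ x, ψ x * layerDensity (n, c) s x =
      ∫ p : EuclideanSpace ℝ (Fin k) × ℝ,
        ψ (hyperplaneCoordinates k hn (p.1, c - s * p.2)) * deriv smoothTransition p.2 := by
  let affine : ℝ ≃ₜ ℝ := (Homeomorph.mulLeft₀ s hs.ne').trans (Homeomorph.subLeft c)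
  let collar : EuclideanSpace ℝ (Fin k) × ℝ ≃ₜ E :=
    ((Homeomorph.refl _).prodCongr affine).trans (hyperplaneCoordinates k hn).toHomeomorph
  have hmul : MeasurePreserving (fun t : ℝ => s * t) (ENNReal.ofReal s • volume) volume := by
    refine ⟨by fun_prop, ?_⟩
    rw [Measure.map_smul, Real.map_volume_mul_left hs.ne', smul_smul, abs_of_pos (inv_pos.2 hs),
      ← ENNReal.ofReal_mul hs.le, mul_inv_cancel₀ hs.ne', ENNReal.ofReal_one, one_smul]
  have hcollar : MeasurePreserving collar (ENNReal.ofReal s • volume) volume := by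
    have hprod := (measurePreserving_hyperplaneCoordinates hn).comp
      ((MeasurePreserving.id (volume : Measure (EuclideanSpace ℝ (Fin k)))).prod
        ((Measure.measurePreserving_sub_left (volume : Measure ℝ) c).comp hmul))
    rwa [Measure.prod_smul_right] at hprod
  rw [← hcollar.integral_comp collar.measurableEmbedding, integral_smul_measure,
    ENNReal.toReal_ofReal hs.le, smul_eq_mul, ← integral_const_mul]
  refine integral_congr_ae (.of_forall fun p => ?_)
  have hp : collar p = hyperplaneCoordinates k hn (p.1, c - s * p.2) := rfl
  have hheight : (c - (c - s * p.2)) / s = p.2 := by field_simp; ring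
  simp only [hp, layerDensity, inner_hyperplaneCoordinates, hheight]
  field_simp

theorem tendsto_integral_mul_layerDensity {n : E} (hn : ‖n‖ = 1) {c B R : ℝ} {ψ : ℝ → E → ℝ}
    {ψ₀ : EuclideanSpace ℝ (Fin k) → ℝ} (hψ : ∀ s, Continuous (ψ s)) (hB : ∀ s x, |ψ s x| ≤ B)
    (hR : ∀ s x, R < ‖x‖ → ψ s x = 0)
    (hlim : ∀ᵐ y : EuclideanSpace ℝ (Fin k), ∀ t : ℝ,
      Tendsto (fun s => ψ s (hyperplaneCoordinates k hn (y, c - s * t))) (𝓝[>] 0) (𝓝 (ψ₀ y))) :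
    Tendsto (fun s => ∫ x, ψ s x * layerDensity (n, c) s x) (𝓝[>] 0) (𝓝 (∫ y, ψ₀ y)) := by
  have hlimit : ∫ y, ψ₀ y =
      ∫ p : EuclideanSpace ℝ (Fin k) × ℝ, ψ₀ p.1 * deriv smoothTransition p.2 := by
    rw [Measure.volume_eq_prod, integral_prod_mul, integral_deriv_smoothTransition, mul_one]
  rw [hlimit]
  refine Tendsto.congr' (f₁ := fun s => ∫ p : EuclideanSpace ℝ (Fin k) × ℝ,
    ψ s (hyperplaneCoordinates k hn (p.1, c - s * p.2)) * deriv smoothTransition p.2) ?_ ?_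
  · filter_upwards [self_mem_nhdsWithin] with s hs
    rw [integral_mul_layerDensity (k := k) hn c hs]
  refine tendsto_integral_filter_of_dominated_convergence
    (fun p => (Metric.closedBall (0 : EuclideanSpace ℝ (Fin k)) R).indicator (fun _ => B) p.1 *
      |deriv smoothTransition p.2|) ?_ ?_ ?_ ?_
  · refine .of_forall fun s => Continuous.aestronglyMeasurable ?_
    exact ((hψ s).comp ((hyperplaneCoordinates k hn).continuous.comp (by fun_prop))).mul
      (continuous_deriv_smoothTransition.comp continuous_snd)
  · refine .of_forall fun s => .of_forall fun p => ?_
    rw [norm_mul, Real.norm_eq_abs, Real.norm_eq_abs]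
    gcongr
    by_cases hp : p.1 ∈ Metric.closedBall 0 R
    · rw [indicator_of_mem hp]
      exact hB s _
    · rw [mem_closedBall_zero_iff, not_le] at hp
      rw [hR s _ (hp.trans_le (norm_fst_le_norm_hyperplaneCoordinates hn (p.1, c - s * p.2))),
        abs_zero]
      exact indicator_nonneg (fun _ _ => (abs_nonneg _).trans (hB 0 0)) _
  · refine Integrable.mul_prod ?_ integrable_deriv_smoothTransition.abs
    rw [integrable_indicator_iff measurableSet_closedBall]
    exact integrableOn_const measure_closedBall_lt_top.ne
  · filter_upwards [Measure.quasiMeasurePreserving_fst.ae hlim] with p hp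
    exact (hp p.2).mul_const _

theorem tendsto_integral_mul_polytopeCutoff_mul_layerDensity {i : E × ℝ} (hi : ‖i.1‖ = 1)
    {J : Finset (E × ℝ)}
    (hJ : ∀ j ∈ J, μHE[k] {x | ⟪i.1, x⟫_ℝ = i.2 ∧ ⟪j.1, x⟫_ℝ = j.2} = 0) {φ : E → ℝ}
    (hφ : Continuous φ) (hφc : HasCompactSupport φ) :
    Tendsto (fun s => ∫ x, φ x * polytopeCutoff J s x * layerDensity i s x) (𝓝[>] 0)
      (𝓝 (∫ x in polytope J ∩ {x | ⟪i.1, x⟫_ℝ = i.2}, φ x ∂μHE[k])) := by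
  let Φ : (EuclideanSpace ℝ (Fin k) × ℝ) ≃L[ℝ] E := hyperplaneCoordinates k hi
  have hslice : MeasurableSet ((fun y => Φ (y, i.2)) ⁻¹' (polytope J ∩ {x | ⟪i.1, x⟫_ℝ = i.2})) :=
    (((isClosed_polytope J).inter (isClosed_eq (by fun_prop) continuous_const)).preimage
      (by fun_prop)).measurableSet
  have hoff : ∀ᵐ y : EuclideanSpace ℝ (Fin k), ∀ j ∈ J, ⟪j.1, Φ (y, i.2)⟫_ℝ ≠ j.2 := by
    refine (Finset.eventually_all J).2 fun j hj => ?_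
    have hnull := hJ j hj
    rw [euclideanHausdorffMeasure_eq_volume_preimage hi fun x hx => hx.1] at hnull
    simpa [ae_iff, inner_hyperplaneCoordinates, Φ] using hnull
  obtain ⟨B, hB⟩ := hφ.bounded_above_of_compact_support hφc
  obtain ⟨R, hR⟩ := hφc.isBounded.exists_norm_le
  rw [setIntegral_euclideanHausdorffMeasure_eq hi fun x hx => hx.2, ← integral_indicator hslice]
  refine tendsto_integral_mul_layerDensity hi (B := B) (R := R)
    (fun s => hφ.mul (continuous_polytopeCutoff J s)) (fun s x => ?_) (fun s x hx => ?_) ?_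
  · rw [abs_mul]
    exact (mul_le_of_le_one_right (abs_nonneg _) (abs_polytopeCutoff_le_one J s x)).trans (hB x)
  · rw [image_eq_zero_of_notMem_tsupport fun h => (hR x h).not_gt hx, zero_mul]
  · filter_upwards [hoff] with y hy t
    have hcollar (s : ℝ) : Φ (y, i.2 - s * t) = Φ (y, i.2) - s • t • i.1 := by
      rw [hyperplaneCoordinates_eq_add_smul hi y _ i.2]
      module
    have hφlim : Tendsto (fun s => φ (Φ (y, i.2 - s * t))) (𝓝[>] 0) (𝓝 (φ (Φ (y, i.2)))) := by
      have hcont : Continuous fun s => φ (Φ (y, i.2 - s * t)) := by fun_prop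
      simpa using (hcont.tendsto 0).mono_left nhdsWithin_le_nhds
    convert hφlim.mul (tendsto_polytopeCutoff hy (t • i.1)) using 2
    · rw [← hcollar]
    · by_cases hyJ : Φ (y, i.2) ∈ polytope J <;>
        simp [hyJ, inner_hyperplaneCoordinates, Φ, indicator]

omit [FiniteDimensional ℝ E] [MeasurableSpace E] [BorelSpace E]
  [Fact (Module.finrank ℝ E = k + 1)] in
theorem exists_mem_hyperplane_inner_ne {i j : E × ℝ} {v : E} (hi : ‖i.1‖ = 1) (hj : ‖j.1‖ = 1)
    (hvi : ⟪i.1, v⟫_ℝ < i.2) (hvj : ⟪j.1, v⟫_ℝ < j.2) (hij : i ≠ j) :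
    ∃ p, ⟪i.1, p⟫_ℝ = i.2 ∧ ⟪j.1, p⟫_ℝ ≠ j.2 := by
  by_contra! hsub
  have hself : ⟪i.1, i.1⟫_ℝ = 1 := by rw [real_inner_self_eq_norm_sq, hi, one_pow]
  set p := v + (i.2 - ⟪i.1, v⟫_ℝ) • i.1 with hp
  have hip : ⟪i.1, p⟫_ℝ = i.2 := by
    rw [hp, inner_add_right, inner_smul_right, hself]
    ring
  have hpos : 0 < ⟪j.1, i.1⟫_ℝ := by
    have hjp := hsub p hip
    rw [hp, inner_add_right, inner_smul_right] at hjp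
    exact pos_of_mul_pos_right (by linarith) (sub_nonneg.2 hvi.le)
  have hone : ⟪j.1, i.1⟫_ℝ = 1 := by
    have hjq := hsub (p + (j.1 - ⟪j.1, i.1⟫_ℝ • i.1)) (by
      rw [inner_add_right, hip, inner_sub_right, inner_smul_right, hself, real_inner_comm]
      ring)
    rw [inner_add_right, hsub p hip, inner_sub_right, inner_smul_right,
      real_inner_self_eq_norm_sq, hj] at hjq
    nlinarith
  have hnormal : j.1 = i.1 := (inner_eq_one_iff_of_norm_eq_one hj hi).1 hone
  exact hij (Prod.ext hnormal.symm (by rw [← hip, ← hsub p hip, hnormal]))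

theorem integral_polytope_fderiv {I : Finset (E × ℝ)} (hI : ∀ i ∈ I, ‖i.1‖ = 1) {v : E}
    (hv : ∀ i ∈ I, ⟪i.1, v⟫_ℝ < i.2) {φ : E → ℝ} (hφ : ContDiff ℝ 1 φ)
    (hφc : HasCompactSupport φ) (u : E) :
    ∫ x in polytope I, fderiv ℝ φ x u =
      ∑ i ∈ I, ⟪i.1, u⟫_ℝ * ∫ x in polytope I ∩ {x | ⟪i.1, x⟫_ℝ = i.2}, φ x ∂μHE[k] := by
  classical
  have hface : ∀ i ∈ I, polytope I ∩ {x | ⟪i.1, x⟫_ℝ = i.2} =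
      polytope (I.erase i) ∩ {x | ⟪i.1, x⟫_ℝ = i.2} := by
    intro i hi
    ext x
    refine and_congr_left fun hx : ⟪i.1, x⟫_ℝ = i.2 =>
      ⟨fun h j hj => h j (Finset.mem_of_mem_erase hj), fun h j hj => ?_⟩
    rcases eq_or_ne j i with rfl | hji
    · exact hx.le
    · exact h j (Finset.mem_erase.2 ⟨hji, hj⟩)
  have hInt : Integrable fun x => fderiv ℝ φ x u :=
    ((hφ.continuous_fderiv one_ne_zero).clm_apply
      continuous_const).integrable_of_hasCompactSupport (hφc.fderiv_apply (𝕜 := ℝ) u)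
  refine tendsto_nhds_unique (tendsto_integral_mul_polytopeCutoff
    (fun i hi => norm_ne_zero_iff.1 ((hI i hi).trans_ne one_ne_zero)) hInt) ?_
  simp only [integral_fderiv_mul_polytopeCutoff hφ hφc]
  refine tendsto_finsetSum _ fun i hi => Tendsto.const_mul _ ?_
  rw [hface i hi]
  refine tendsto_integral_mul_polytopeCutoff_mul_layerDensity (hI i hi) (fun j hj => ?_)
    hφ.continuous hφc
  obtain ⟨hji, hj⟩ := Finset.mem_erase.1 hj
  obtain ⟨p, hp, hp'⟩ :=
    exists_mem_hyperplane_inner_ne (hI i hi) (hI j hj) (hv i hi) (hv j hj) hji.symm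
  exact euclideanHausdorffMeasure_hyperplane_inter_eq_zero (hI i hi) hp hp'

end Divergence

section Separation

variable {E : Type*} [NormedAddCommGroup E] [InnerProductSpace ℝ E] {S T : Set E}

theorem inner_lt_of_mem_interior {n v : E} {c : ℝ} (hn : n ≠ 0) (hS : ∀ x ∈ S, ⟪n, x⟫_ℝ ≤ c)
    (hv : v ∈ interior S) : ⟪n, v⟫_ℝ < c := by
  have hopen : IsOpenMap (innerSL ℝ n) := (innerSL ℝ n).isOpenMap_of_ne_zero fun h =>
    hn (inner_self_eq_zero.1 (congrArg (· n) h))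
  have hmem : ⟪n, v⟫_ℝ ∈ interior (Iic c) :=
    interior_mono (image_subset_iff.2 fun x hx => hS x hx : innerSL ℝ n '' S ⊆ Iic c)
      (hopen.image_interior_subset S (mem_image_of_mem _ hv))
  rwa [interior_Iic] at hmem

theorem lt_inner_of_mem_interior {n v : E} {c : ℝ} (hn : n ≠ 0) (hS : ∀ x ∈ S, c ≤ ⟪n, x⟫_ℝ)
    (hv : v ∈ interior S) : c < ⟪n, v⟫_ℝ := by
  have hneg := inner_lt_of_mem_interior (c := -c) (neg_ne_zero.2 hn)
    (fun x hx => by rw [inner_neg_left]; exact neg_le_neg (hS x hx)) hv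
  rw [inner_neg_left] at hneg
  exact neg_lt_neg_iff.1 hneg

theorem exists_unit_normal_separating [CompleteSpace E] (hS : Convex ℝ S) (hT : Convex ℝ T)
    (hSne : (interior S).Nonempty) (hTne : (interior T).Nonempty)
    (hST : Disjoint (interior S) (interior T)) :
    ∃ (n : E) (c : ℝ), ‖n‖ = 1 ∧ (∀ x ∈ S, ⟪n, x⟫_ℝ ≤ c) ∧ ∀ x ∈ T, c ≤ ⟪n, x⟫_ℝ := by
  obtain ⟨f, c, hf, hfS, hfT⟩ :=
    geometric_hahn_banach_of_nonempty_interior hS hT.interior hST hSne hTne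
  have hfT' : T ⊆ {x | c ≤ f x} := by
    refine (subset_closure.trans_eq
      (hT.closure_interior_eq_closure_of_nonempty_interior hTne).symm).trans ?_
    exact closure_minimal (fun x hx => hfT x hx) (isClosed_le continuous_const f.continuous)
  obtain ⟨m, rfl⟩ := (InnerProductSpace.toDual ℝ E).surjective f
  have hm : m ≠ 0 := by simpa using hf
  simp only [InnerProductSpace.toDual_apply_apply] at hfS hfT'
  refine ⟨‖m‖⁻¹ • m, ‖m‖⁻¹ * c, norm_smul_inv_norm (𝕜 := ℝ) hm, fun x hx => ?_, fun x hx => ?_⟩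
  · rw [real_inner_smul_left]
    gcongr
    exact hfS x hx
  · rw [real_inner_smul_left]
    gcongr
    exact hfT' hx

end Separation

namespace Tiling

section Geometry

variable {d : ℕ} {D : Set (EuclideanSpace ℝ (Fin d))} (G : Tiling d D)
  {v w : EuclideanSpace ℝ (Fin d)}

theorem convex_tile (hv : v ∈ G.verts) : Convex ℝ (G.tile v) := by
  obtain ⟨s, -, hs⟩ := G.isPolytope v hv
  exact hs ▸ convex_convexHull ℝ s

theorem isCompact_tile (hv : v ∈ G.verts) : IsCompact (G.tile v) := by
  obtain ⟨s, hfin, hs⟩ := G.isPolytope v hv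
  exact hs ▸ hfin.isCompact_convexHull ℝ

theorem measurableSet_tile (hv : v ∈ G.verts) : MeasurableSet (G.tile v) :=
  (G.isCompact_tile hv).isClosed.measurableSet

theorem mem_tile (hv : v ∈ G.verts) : v ∈ G.tile v := interior_subset (G.mem_interior v hv)

theorem facet_comm (w v : EuclideanSpace ℝ (Fin d)) : G.facet w v = G.facet v w :=
  inter_comm _ _

theorem isCompact_facet (hw : w ∈ G.verts) (hv : v ∈ G.verts) : IsCompact (G.facet w v) :=
  (G.isCompact_tile hw).inter (G.isCompact_tile hv)

theorem convex_facet (hw : w ∈ G.verts) (hv : v ∈ G.verts) : Convex ℝ (G.facet w v) :=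
  (G.convex_tile hw).inter (G.convex_tile hv)

/-- The hyperplane `{x | ⟪n, x⟫ = c}` with unit normal `n`, given as the pair `i = (n, c)`,
separates the tile of `v` from the tile of `w`, with `n` pointing towards `w`. -/
structure Separates (i : EuclideanSpace ℝ (Fin d) × ℝ) (v w : EuclideanSpace ℝ (Fin d)) :
    Prop where
  norm_eq_one : ‖i.1‖ = 1
  inner_le : ∀ x ∈ G.tile v, ⟪i.1, x⟫_ℝ ≤ i.2
  le_inner : ∀ x ∈ G.tile w, i.2 ≤ ⟪i.1, x⟫_ℝ
  inner_lt : ⟪i.1, v⟫_ℝ < i.2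
  lt_inner : i.2 < ⟪i.1, w⟫_ℝ

theorem exists_separates (hv : v ∈ G.verts) (hw : w ∈ G.verts) (hvw : v ≠ w) :
    ∃ i, G.Separates i v w := by
  obtain ⟨n, c, hn, hle, hge⟩ := exists_unit_normal_separating (G.convex_tile hv)
    (G.convex_tile hw) ⟨v, G.mem_interior v hv⟩ ⟨w, G.mem_interior w hw⟩
    (G.disjoint_interior v hv w hw hvw)
  have hn0 : n ≠ 0 := norm_ne_zero_iff.1 (hn.trans_ne one_ne_zero)
  exact ⟨(n, c), hn, hle, hge, inner_lt_of_mem_interior hn0 hle (G.mem_interior v hv),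
    lt_inner_of_mem_interior hn0 hge (G.mem_interior w hw)⟩

open scoped Classical in
/-- A choice of a hyperplane separating the tile of `v` from the tile of `w`, with the junk value
`0` if there is none. -/
noncomputable def separator (v w : EuclideanSpace ℝ (Fin d)) : EuclideanSpace ℝ (Fin d) × ℝ :=
  if h : ∃ i, G.Separates i v w then h.choose else 0

theorem separates_separator (hv : v ∈ G.verts) (hw : w ∈ G.verts) (hvw : v ≠ w) :
    G.Separates (G.separator v w) v w := by
  have hex := G.exists_separates hv hw hvw
  rw [separator, dif_pos hex]
  exact hex.choose_spec

variable {G}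

namespace Separates

variable {i : EuclideanSpace ℝ (Fin d) × ℝ}

theorem ne_zero (hs : G.Separates i v w) : i.1 ≠ 0 :=
  norm_ne_zero_iff.1 (hs.norm_eq_one.trans_ne one_ne_zero)

theorem symm (hs : G.Separates i v w) : G.Separates (-i) w v where
  norm_eq_one := by rw [Prod.fst_neg, norm_neg, hs.norm_eq_one]
  inner_le x hx := by simpa using hs.le_inner x hx
  le_inner x hx := by simpa using hs.inner_le x hx
  inner_lt := by simpa using hs.lt_inner
  lt_inner := by simpa using hs.inner_lt

theorem inner_eq (hs : G.Separates i v w) {x : EuclideanSpace ℝ (Fin d)}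
    (hx : x ∈ G.facet w v) : ⟪i.1, x⟫_ℝ = i.2 :=
  le_antisymm (hs.inner_le x hx.2) (hs.le_inner x hx.1)

theorem direction_affineSpan_facet (hs : G.Separates i v w) (h : G.Adj w v) :
    (affineSpan ℝ (G.facet w v)).direction = (ℝ ∙ i.1)ᗮ := by
  apply Submodule.eq_of_le_of_finrank_eq
  · rw [direction_affineSpan, vectorSpan_def, Submodule.span_le]
    rintro _ ⟨x, hx, y, hy, rfl⟩
    refine Submodule.mem_orthogonal_singleton_iff_inner_right.2 ?_
    change ⟪i.1, x - y⟫_ℝ = 0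
    rw [inner_sub_right, hs.inner_eq hx, hs.inner_eq hy, sub_self]
  · have hrank := (ℝ ∙ i.1).finrank_add_finrank_orthogonal
    rw [finrank_span_singleton hs.ne_zero, finrank_euclideanSpace_fin] at hrank
    have := h.2.2.2.2
    omega

theorem sub_eq_norm_smul (hs : G.Separates i v w) (hG : G.IsOrthogonal) (h : G.Adj w v) :
    w - v = ‖w - v‖ • i.1 := by
  have hmem : w - v ∈ ((ℝ ∙ i.1)ᗮ)ᗮ := by
    rw [← hs.direction_affineSpan_facet h, Submodule.mem_orthogonal']
    exact hG w v h
  rw [Submodule.orthogonal_orthogonal, Submodule.mem_span_singleton] at hmem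
  obtain ⟨t, ht⟩ := hmem
  have htpos : 0 < t := by
    have hinner : ⟪i.1, w - v⟫_ℝ = t := by
      rw [← ht, inner_smul_right, real_inner_self_eq_norm_sq, hs.norm_eq_one, one_pow, mul_one]
    rw [← hinner, inner_sub_right]
    exact sub_pos.2 (hs.inner_lt.trans hs.lt_inner)
  rw [← ht, norm_smul, hs.norm_eq_one, mul_one, Real.norm_of_nonneg htpos.le]

end Separates

theorem Adj.symm (h : G.Adj w v) : G.Adj v w := by
  obtain ⟨hw, hv, hne, hfacet, hrank⟩ := h
  rw [facet_comm] at hfacet hrank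
  exact ⟨hv, hw, hne.symm, hfacet, hrank⟩

theorem Adj.norm_sub_pos (h : G.Adj w v) : 0 < ‖w - v‖ := norm_pos_iff.2 (sub_ne_zero.2 h.2.2.1)

variable (G)

/-- The vertices of the tiles which meet the tile of `v`, in a facet or in a set of lower
dimension. -/
def touching (v : EuclideanSpace ℝ (Fin d)) : Set (EuclideanSpace ℝ (Fin d)) :=
  {w | w ∈ G.verts ∧ w ≠ v ∧ (G.facet w v).Nonempty}

theorem finite_touching (hv : v ∈ G.verts) (hvD : G.tile v ⊆ D) : (G.touching v).Finite :=
  (G.locallyFinite _ hvD (G.isCompact_tile hv)).subset fun _ hw => ⟨hw.1, hw.2.2⟩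

variable {G} in
theorem Adj.mem_touching (h : G.Adj w v) : w ∈ G.touching v := ⟨h.1, h.2.2.1, h.2.2.2.1⟩

theorem exists_touching_of_notMem_interior (hvD : G.tile v ⊆ interior D)
    {y : EuclideanSpace ℝ (Fin d)} (hy : y ∈ G.tile v) (hyi : y ∉ interior (G.tile v)) :
    ∃ w ∈ G.touching v, y ∈ G.tile w := by
  obtain ⟨r, hr, hrD⟩ := Metric.nhds_basis_closedBall.mem_iff.1
    (mem_interior_iff_mem_nhds.1 (hvD hy))
  let N := {w | w ∈ G.verts ∧ (G.tile w ∩ Metric.closedBall y r).Nonempty} \ {v}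
  have hNfin : N.Finite := (G.locallyFinite _ hrD (isCompact_closedBall y r)).subset sdiff_subset
  have hclosed : IsClosed (⋃ w ∈ N, G.tile w) :=
    hNfin.isClosed_biUnion fun w hw => (G.isCompact_tile hw.1.1).isClosed
  have hcover : Metric.ball y r ∩ (G.tile v)ᶜ ⊆ ⋃ w ∈ N, G.tile w := by
    rintro x ⟨hxr, hxv⟩
    have hxr' := Metric.ball_subset_closedBall hxr
    obtain ⟨w, hw, hxw⟩ := mem_iUnion₂.1 (G.cover (hrD hxr'))
    refine mem_biUnion ⟨⟨hw, x, hxw, hxr'⟩, ?_⟩ hxw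
    rintro rfl
    exact hxv hxw
  have hyN : y ∈ closure (Metric.ball y r ∩ (G.tile v)ᶜ) :=
    Metric.isOpen_ball.inter_closure ⟨Metric.mem_ball_self hr, by rwa [closure_compl]⟩
  obtain ⟨w, hw, hyw⟩ := mem_iUnion₂.1 (closure_minimal hcover hclosed hyN)
  exact ⟨w, ⟨hw.1.1, hw.2, y, hyw, hy⟩, hyw⟩

open scoped Classical in
theorem tile_eq_polytope (hv : v ∈ G.verts) (hvD : G.tile v ⊆ interior D)
    {T : Finset (EuclideanSpace ℝ (Fin d))} (hT : ∀ w, w ∈ T ↔ w ∈ G.touching v) :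
    G.tile v = polytope (T.image (G.separator v)) := by
  set P := polytope (T.image (G.separator v)) with hP
  have hsep : ∀ w ∈ T, G.Separates (G.separator v w) v w := fun w hw =>
    G.separates_separator hv ((hT w).1 hw).1 ((hT w).1 hw).2.1.symm
  have hle {w x : EuclideanSpace ℝ (Fin d)} (hw : w ∈ T) (hx : x ∈ P) :
      ⟪(G.separator v w).1, x⟫_ℝ ≤ (G.separator v w).2 :=
    hx _ (Finset.mem_image_of_mem _ hw)
  have hsub : G.tile v ⊆ P := by
    intro x hx i hi
    obtain ⟨w, hw, rfl⟩ := Finset.mem_image.1 hi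
    exact (hsep w hw).inner_le x hx
  have hconv : Convex ℝ P := by
    simp only [hP, polytope, ofPred_forall]
    exact convex_iInter₂ fun i _ => convex_halfSpace_le (innerₛₗ ℝ i.1).isLinear i.2
  have hvP : v ∈ interior P := interior_mono hsub (G.mem_interior v hv)
  have hInt : interior P ⊆ interior (G.tile v) := by
    refine hconv.interior.isPreconnected.subset_left_of_subset_union isOpen_interior
      (G.isCompact_tile hv).isClosed.isOpen_compl (disjoint_compl_right.mono_left interior_subset)
      (fun x hx => or_iff_not_imp_right.2 fun hxv => ?_) ⟨v, hvP, G.mem_interior v hv⟩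
    by_contra hxi
    obtain ⟨w, hw, hxw⟩ := G.exists_touching_of_notMem_interior hvD (not_not.1 hxv) hxi
    rw [← hT] at hw
    exact ((hsep w hw).le_inner x hxw).not_gt
      (inner_lt_of_mem_interior (hsep w hw).ne_zero (fun y hy => hle hw hy) hx)
  refine hsub.antisymm (subset_closure.trans ?_)
  rw [← hconv.closure_interior_eq_closure_of_nonempty_interior ⟨v, hvP⟩]
  exact closure_minimal (hInt.trans interior_subset) (G.isCompact_tile hv).isClosed

end Geometry

end Tiling

section LocalExtension

open scoped Manifold in
theorem exists_contDiff_hasCompactSupport_eventuallyEq {E : Type*} [NormedAddCommGroup E]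
    [InnerProductSpace ℝ E] [FiniteDimensional ℝ E] {K : Set E} (hK : IsCompact K) {φ : E → ℝ}
    (hφ : ∀ x ∈ K, ContDiffAt ℝ 1 φ x) :
    ∃ ψ : E → ℝ, ContDiff ℝ 1 ψ ∧ HasCompactSupport ψ ∧ ∀ x ∈ K, ψ =ᶠ[nhds x] φ := by
  have hopen : IsOpen {x | ContDiffAt ℝ 1 φ x} :=
    isOpen_iff_mem_nhds.2 fun x (hx : ContDiffAt ℝ 1 φ x) => hx.eventually (by simp)
  obtain ⟨L, hL, hKL, hLφ⟩ := exists_compact_between hK hopen hφ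
  obtain ⟨f, hf1, hf0, -⟩ :=
    exists_contMDiffMap_one_nhds_of_subset_interior (n := 1) 𝓘(ℝ, E) hK.isClosed hKL
  have hzero : ∀ x ∉ L, f x * φ x = 0 := fun x hx => by rw [hf0 x hx, zero_mul]
  refine ⟨fun x => f x * φ x, contDiff_iff_contDiffAt.2 fun x => ?_,
    HasCompactSupport.intro hL hzero, fun x hx => ?_⟩
  · by_cases hx : x ∈ L
    · exact f.contMDiff.contDiff.contDiffAt.mul (hLφ hx)
    · refine (contDiffAt_const (c := (0 : ℝ))).congr_of_eventuallyEq ?_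
      filter_upwards [hL.isClosed.isOpen_compl.mem_nhds hx] with y hy using hzero y hy
  · filter_upwards [(eventually_nhdsSet_iff_forall.1 hf1) x hx] with y hy
    rw [hy, one_mul]

end LocalExtension

namespace Tiling

section DivergenceTheorem

variable {k : ℕ} {D : Set (EuclideanSpace ℝ (Fin (k + 1)))} (G : Tiling (k + 1) D)
  {v w z : EuclideanSpace ℝ (Fin (k + 1))}

instance fact_finrank_euclideanSpace_succ :
    Fact (Module.finrank ℝ (EuclideanSpace ℝ (Fin (k + 1))) = k + 1) :=
  ⟨finrank_euclideanSpace_fin⟩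

variable {G} in
theorem Separates.hausdorffMeasure_inter_eq_zero {i j : EuclideanSpace ℝ (Fin (k + 1)) × ℝ}
    (hi : G.Separates i v w) (hj : G.Separates j v z) (hij : i ≠ j) :
    μHE[k] {x | ⟪i.1, x⟫_ℝ = i.2 ∧ ⟪j.1, x⟫_ℝ = j.2} = 0 := by
  obtain ⟨p, hp, hp'⟩ := exists_mem_hyperplane_inner_ne hi.norm_eq_one hj.norm_eq_one hi.inner_lt
    hj.inner_lt hij
  exact euclideanHausdorffMeasure_hyperplane_inter_eq_zero hi.norm_eq_one hp hp'

theorem aedisjoint_facet (hv : v ∈ G.verts) (hw : w ∈ G.verts) (hz : z ∈ G.verts) (hwv : w ≠ v)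
    (hzv : z ≠ v) (hwz : w ≠ z) : AEDisjoint μHE[k] (G.facet w v) (G.facet z v) := by
  have hi := G.separates_separator hv hw hwv.symm
  have hj := G.separates_separator hv hz hzv.symm
  have hl := G.separates_separator hw hz hwz
  by_cases hij : G.separator v w = G.separator v z
  · have hil : -G.separator v w ≠ G.separator w z := fun h => by
      have hzl := hl.lt_inner
      rw [← h, hij, Prod.fst_neg, Prod.snd_neg, inner_neg_left] at hzl
      exact (neg_lt_neg_iff.1 hzl).not_gt hj.lt_inner
    refine measure_mono_null (fun x hx => ?_) (hi.symm.hausdorffMeasure_inter_eq_zero hl hil)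
    exact ⟨hi.symm.inner_eq ⟨hx.1.2, hx.1.1⟩, hl.inner_eq ⟨hx.2.1, hx.1.1⟩⟩
  · refine measure_mono_null (fun x hx => ?_) (hi.hausdorffMeasure_inter_eq_zero hj hij)
    exact ⟨hi.inner_eq hx.1, hj.inner_eq hx.2⟩

theorem volume_facet (hw : w ∈ G.verts) (hv : v ∈ G.verts) (hwv : w ≠ v) :
    volume (G.facet w v) = 0 := by
  have hs := G.separates_separator hv hw hwv.symm
  refine measure_mono_null (fun x hx => ?_) (ae_iff.1 (ae_inner_ne hs.ne_zero (G.separator v w).2))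
  exact not_not.2 (hs.inner_eq hx)

theorem hausdorffMeasure_facet_ne_top (hw : w ∈ G.verts) (hv : v ∈ G.verts) (hwv : w ≠ v) :
    μHE[k] (G.facet w v) ≠ ⊤ := by
  have hs := G.separates_separator hv hw hwv.symm
  exact euclideanHausdorffMeasure_ne_top_of_isCompact hs.norm_eq_one (fun _ => hs.inner_eq)
    (G.isCompact_facet hw hv)

theorem hausdorffMeasure_facet_eq_zero (hw : w ∈ G.verts) (hv : v ∈ G.verts) (hwv : w ≠ v)
    (hadj : ¬G.Adj w v) : μHE[k] (G.facet w v) = 0 := by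
  have hs := G.separates_separator hv hw hwv.symm
  exact euclideanHausdorffMeasure_eq_zero_of_finrank_ne hs.norm_eq_one (fun _ => hs.inner_eq)
    fun hne hrank => hadj ⟨hw, hv, hwv, hne, congrArg (· + 1) hrank⟩

theorem integrableOn_facet (hw : w ∈ G.verts) (hv : v ∈ G.verts) (hwv : w ≠ v)
    {φ : EuclideanSpace ℝ (Fin (k + 1)) → ℝ} (hφ : ContinuousOn φ (G.facet w v)) :
    IntegrableOn φ (G.facet w v) μHE[k] :=
  hφ.integrableOn_of_subset_isCompact (G.isCompact_facet hw hv)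
    (G.isCompact_facet hw hv).isClosed.measurableSet Subset.rfl
    (G.hausdorffMeasure_facet_ne_top hw hv hwv)

variable {T : Finset (EuclideanSpace ℝ (Fin (k + 1)))}

open scoped Classical in
/-- A point of the face which is in none of these facets lies in the tile of another touching vertex
and hence on a second bounding hyperplane. -/
theorem biUnion_facet_ae_eq_face (hv : v ∈ G.verts) (hvD : G.tile v ⊆ interior D)
    (hT : ∀ w, w ∈ T ↔ w ∈ G.touching v) {i : EuclideanSpace ℝ (Fin (k + 1)) × ℝ}
    (hi : i ∈ T.image (G.separator v)) :
    (⋃ w ∈ T.filter (G.separator v · = i), G.facet w v) =ᵐ[μHE[k]]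
      (G.tile v ∩ {x | ⟪i.1, x⟫_ℝ = i.2} : Set (EuclideanSpace ℝ (Fin (k + 1)))) := by
  have hsep : ∀ w ∈ T, G.Separates (G.separator v w) v w := fun w hw =>
    G.separates_separator hv ((hT w).1 hw).1 ((hT w).1 hw).2.1.symm
  refine Filter.EventuallyLE.antisymm (LE.le.eventuallyLE ?_) ?_
  · refine iUnion₂_subset fun w hw x hx => ⟨hx.2, ?_⟩
    obtain ⟨hwT, rfl⟩ := Finset.mem_filter.1 hw
    exact (hsep w hwT).inner_eq hx
  · obtain ⟨w₀, hw₀, rfl⟩ := Finset.mem_image.1 hi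
    set i := G.separator v w₀
    refine ae_le_set.2 (measure_mono_null (t := ⋃ w ∈ T.filter (G.separator v · ≠ i),
      {x | ⟪i.1, x⟫_ℝ = i.2 ∧ ⟪(G.separator v w).1, x⟫_ℝ = (G.separator v w).2}) ?_ ?_)
    · rintro x ⟨⟨hxv, hxi⟩, hxfacets⟩
      have hxint : x ∉ interior (G.tile v) := fun h =>
        (inner_lt_of_mem_interior (hsep w₀ hw₀).ne_zero (hsep w₀ hw₀).inner_le h).ne hxi
      obtain ⟨w, hw, hxw⟩ := G.exists_touching_of_notMem_interior hvD hxv hxint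
      rw [← hT] at hw
      by_cases hwi : G.separator v w = i
      · exact (hxfacets (mem_iUnion₂.2 ⟨w, Finset.mem_filter.2 ⟨hw, hwi⟩, hxw, hxv⟩)).elim
      · exact mem_iUnion₂.2
          ⟨w, Finset.mem_filter.2 ⟨hw, hwi⟩, hxi, (hsep w hw).inner_eq ⟨hxw, hxv⟩⟩
    · refine (measure_biUnion_null_iff (Finset.countable_toSet _)).2 fun w hw => ?_
      obtain ⟨hwT, hwi⟩ := Finset.mem_filter.1 hw
      exact (hsep w₀ hw₀).hausdorffMeasure_inter_eq_zero (hsep w hwT) (Ne.symm hwi)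

open scoped Classical in
theorem setIntegral_face (hv : v ∈ G.verts) (hvD : G.tile v ⊆ interior D)
    (hT : ∀ w, w ∈ T ↔ w ∈ G.touching v) {i : EuclideanSpace ℝ (Fin (k + 1)) × ℝ}
    (hi : i ∈ T.image (G.separator v)) {φ : EuclideanSpace ℝ (Fin (k + 1)) → ℝ}
    (hφ : Continuous φ) :
    ∫ x in G.tile v ∩ {x | ⟪i.1, x⟫_ℝ = i.2}, φ x ∂μHE[k] =
      ∑ w ∈ T with G.separator v w = i, ∫ x in G.facet w v, φ x ∂μHE[k] := by
  have hT' {w} (hw : w ∈ T.filter (G.separator v · = i)) : w ∈ G.verts ∧ w ≠ v :=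
    have hw' := (hT w).1 (Finset.mem_of_mem_filter w hw)
    ⟨hw'.1, hw'.2.1⟩
  rw [← setIntegral_congr_set (G.biUnion_facet_ae_eq_face hv hvD hT hi), ← Finset.set_biUnion_coe,
    biUnion_eq_iUnion, integral_iUnion_ae, tsum_fintype]
  · exact Finset.sum_coe_sort (T.filter _) fun w => ∫ x in G.facet w v, φ x ∂μHE[k]
  · exact fun w => (G.isCompact_facet (hT' w.2).1 hv).isClosed.measurableSet.nullMeasurableSet
  · exact fun w z hwz => G.aedisjoint_facet hv (hT' w.2).1 (hT' z.2).1 (hT' w.2).2 (hT' z.2).2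
      fun h => hwz (Subtype.ext h)
  · rw [integrableOn_finite_iUnion]
    exact fun w => G.integrableOn_facet (hT' w.2).1 hv (hT' w.2).2 hφ.continuousOn

variable {N : Finset (EuclideanSpace ℝ (Fin (k + 1)))}
  {φ h : EuclideanSpace ℝ (Fin (k + 1)) → ℝ}

theorem integral_tile_fderiv_eq_sum_touching (hv : v ∈ G.verts) (hvD : G.tile v ⊆ interior D)
    (hT : ∀ w, w ∈ T ↔ w ∈ G.touching v) (hφ : ContDiff ℝ 1 φ) (hφc : HasCompactSupport φ)
    (u : EuclideanSpace ℝ (Fin (k + 1))) :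
    ∫ x in G.tile v, fderiv ℝ φ x u =
      ∑ w ∈ T, ⟪(G.separator v w).1, u⟫_ℝ * ∫ x in G.facet w v, φ x ∂μHE[k] := by
  classical
  have hsep : ∀ i ∈ T.image (G.separator v), ∃ w, G.Separates i v w := fun i hi => by
    obtain ⟨w, hw, rfl⟩ := Finset.mem_image.1 hi
    exact ⟨w, G.separates_separator hv ((hT w).1 hw).1 ((hT w).1 hw).2.1.symm⟩
  have hdiv := integral_polytope_fderiv (k := k) (I := T.image (G.separator v)) (v := v)
    (fun i hi => (hsep i hi).choose_spec.norm_eq_one)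
    (fun i hi => (hsep i hi).choose_spec.inner_lt) hφ hφc u
  rw [← G.tile_eq_polytope hv hvD hT] at hdiv
  rw [hdiv, ← Finset.sum_fiberwise_of_maps_to (s := T) (g := G.separator v) fun w hw =>
    Finset.mem_image_of_mem _ hw]
  refine Finset.sum_congr rfl fun i hi => ?_
  rw [G.setIntegral_face hv hvD hT hi hφ.continuous, Finset.mul_sum]
  refine Finset.sum_congr rfl fun w hw => ?_
  rw [(Finset.mem_filter.1 hw).2]

theorem integral_tile_fderiv_of_contDiff (hG : G.IsOrthogonal) (hv : v ∈ G.verts)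
    (hvD : G.tile v ⊆ interior D) (hN : ∀ w ∈ N, w ∈ G.verts) (hNv : ∀ w, G.Adj w v → w ∈ N)
    (hφ : ContDiff ℝ 1 φ) (hφc : HasCompactSupport φ) (u : EuclideanSpace ℝ (Fin (k + 1))) :
    ∫ x in G.tile v, fderiv ℝ φ x u =
      ∑ w ∈ N, ‖w - v‖⁻¹ * ⟪w - v, u⟫_ℝ * ∫ x in G.facet w v, φ x ∂μHE[k] := by
  classical
  have hnull {w} (hw : w ∈ G.verts) (hwv : w ≠ v) (hadj : ¬G.Adj w v) :
      ∫ x in G.facet w v, φ x ∂μHE[k] = 0 :=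
    setIntegral_measure_zero _ (G.hausdorffMeasure_facet_eq_zero hw hv hwv hadj)
  let T := (G.finite_touching hv (hvD.trans interior_subset)).toFinset
  have hT (w) : w ∈ T ↔ w ∈ G.touching v := Finite.mem_toFinset _
  have hTN : T.filter (G.Adj · v) = N.filter (G.Adj · v) := by
    ext w
    simp only [Finset.mem_filter, and_congr_left_iff]
    exact fun hadj => iff_of_true ((hT w).2 hadj.mem_touching) (hNv w hadj)
  rw [G.integral_tile_fderiv_eq_sum_touching hv hvD hT hφ hφc,
    ← Finset.sum_filter_of_ne (p := (G.Adj · v)), hTN,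
    ← Finset.sum_filter_of_ne (s := N) (p := (G.Adj · v))]
  · refine Finset.sum_congr rfl fun w hw => ?_
    have hadj := (Finset.mem_filter.1 hw).2
    have hs := G.separates_separator hv hadj.1 hadj.2.2.1.symm
    have hinner : ⟪w - v, u⟫_ℝ = ‖w - v‖ * ⟪(G.separator v w).1, u⟫_ℝ := by
      conv_lhs => rw [hs.sub_eq_norm_smul hG hadj, real_inner_smul_left]
    rw [hinner, inv_mul_cancel_left₀ hadj.norm_sub_pos.ne']
  · intro w hw
    contrapose!
    intro hadj
    rcases eq_or_ne w v with rfl | hwv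
    · simp
    · rw [hnull (hN w hw) hwv hadj, mul_zero]
  · intro w hw
    contrapose!
    intro hadj
    rw [hnull ((hT w).1 hw).1 ((hT w).1 hw).2.1 hadj, mul_zero]

theorem integral_tile_fderiv (hG : G.IsOrthogonal) (hv : v ∈ G.verts)
    (hvD : G.tile v ⊆ interior D) (hN : ∀ w ∈ N, w ∈ G.verts) (hNv : ∀ w, G.Adj w v → w ∈ N)
    (hφ : ∀ x ∈ G.tile v, ContDiffAt ℝ 1 φ x) (u : EuclideanSpace ℝ (Fin (k + 1))) :
    ∫ x in G.tile v, fderiv ℝ φ x u =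
      ∑ w ∈ N, ‖w - v‖⁻¹ * ⟪w - v, u⟫_ℝ * ∫ x in G.facet w v, φ x ∂μHE[k] := by
  obtain ⟨ψ, hψ, hψc, hψφ⟩ :=
    exists_contDiff_hasCompactSupport_eventuallyEq (G.isCompact_tile hv) hφ
  rw [setIntegral_congr_fun (G.measurableSet_tile hv) fun x hx => by rw [← (hψφ x hx).fderiv_eq],
    G.integral_tile_fderiv_of_contDiff hG hv hvD hN hNv hψ hψc u]
  refine Finset.sum_congr rfl fun w hw => ?_
  rw [setIntegral_congr_fun (G.isCompact_facet (hN w hw) hv).isClosed.measurableSet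
    fun x hx => (hψφ x hx.2).eq_of_nhds]

end DivergenceTheorem

end Tiling

section Laplacian

variable {E ι : Type*} [NormedAddCommGroup E] [InnerProductSpace ℝ E] [Fintype ι]
  (b : OrthonormalBasis ι ℝ E)

theorem apply_eq_sum_inner_mul (f : E →ₗ[ℝ] ℝ) (u : E) : f u = ∑ i, ⟪u, b i⟫_ℝ * f (b i) := by
  conv_lhs => rw [← b.sum_repr' u]
  simp only [map_sum, map_smul, smul_eq_mul, real_inner_comm]

theorem laplacian_eq_sum_fderiv_fderiv [FiniteDimensional ℝ E] {h : E → ℝ} {x : E}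
    (hh : DifferentiableAt ℝ (fderiv ℝ h) x) :
    Laplacian.laplacian h x = ∑ i, fderiv ℝ (fun y => fderiv ℝ h y (b i)) x (b i) := by
  rw [InnerProductSpace.laplacian_eq_iteratedFDeriv_orthonormalBasis h b]
  refine Finset.sum_congr rfl fun i _ => ?_
  rw [iteratedFDeriv_two_apply, fderiv_clm_apply hh (differentiableAt_const _)]
  simp

end Laplacian

namespace Tiling

section Cones

variable {k : ℕ} {D : Set (EuclideanSpace ℝ (Fin (k + 1)))} (G : Tiling (k + 1) D)
  {v w z : EuclideanSpace ℝ (Fin (k + 1))} {N : Finset (EuclideanSpace ℝ (Fin (k + 1)))}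

/-- The cone with apex `v` over the facet `P_w ∩ P_v`, the half of the dual polytope `Q_(w,v)` which
lies in `P_v`. -/
def cone (w v : EuclideanSpace ℝ (Fin (k + 1))) : Set (EuclideanSpace ℝ (Fin (k + 1))) :=
  convexHull ℝ (insert v (G.facet w v))

theorem dualPolytope_eq_cone_union_cone (w v : EuclideanSpace ℝ (Fin (k + 1))) :
    G.dualPolytope w v = G.cone v w ∪ G.cone w v := by
  rw [dualPolytope, cone, cone, facet_comm]

theorem isCompact_cone (hw : w ∈ G.verts) (hv : v ∈ G.verts) : IsCompact (G.cone w v) :=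
  isCompact_convexHull_insert (G.isCompact_facet hw hv) (G.convex_facet hw hv) v

theorem cone_subset_tile (hv : v ∈ G.verts) : G.cone w v ⊆ G.tile v :=
  convexHull_min (insert_subset (G.mem_tile hv) inter_subset_right) (G.convex_tile hv)

variable {G} in
theorem Separates.volume_convexHull_insert {i : EuclideanSpace ℝ (Fin (k + 1)) × ℝ}
    (hi : G.Separates i v w) {S : Set (EuclideanSpace ℝ (Fin (k + 1)))} (hS : S ⊆ G.facet w v)
    (hSc : Convex ℝ S) (hScomp : IsCompact S) :
    volume (convexHull ℝ (insert v S)) =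
      ENNReal.ofReal ((i.2 - ⟪i.1, v⟫_ℝ) / (k + 1)) * μHE[k] S := by
  rcases S.eq_empty_or_nonempty with rfl | hne
  · simp
  have hpos : 0 < i.2 - ⟪i.1, v⟫_ℝ := sub_pos.2 hi.inner_lt
  have hnorm : ‖(i.2 - ⟪i.1, v⟫_ℝ) • i.1‖ = i.2 - ⟪i.1, v⟫_ℝ := by
    rw [norm_smul, hi.norm_eq_one, mul_one, Real.norm_of_nonneg hpos.le]
  have hvol := _root_.volume_convexHull_insert (p := v) (smul_ne_zero hpos.ne' hi.ne_zero) hSc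
    hScomp hne fun s hs => by
      rw [hnorm, real_inner_smul_left, inner_sub_right, hi.inner_eq (hS hs), sq]
  rwa [hnorm, finrank_euclideanSpace_fin, Nat.add_sub_cancel, Nat.cast_succ] at hvol

variable {G} in
theorem Separates.volumeReal_cone {i : EuclideanSpace ℝ (Fin (k + 1)) × ℝ}
    (hi : G.Separates i v w) (hw : w ∈ G.verts) (hv : v ∈ G.verts) :
    volume.real (G.cone w v) = (i.2 - ⟪i.1, v⟫_ℝ) / (k + 1) * μHE[k].real (G.facet w v) := by
  rw [measureReal_def, cone, hi.volume_convexHull_insert Subset.rfl (G.convex_facet hw hv)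
    (G.isCompact_facet hw hv), ENNReal.toReal_mul, ENNReal.toReal_ofReal, measureReal_def]
  exact div_nonneg (sub_nonneg.2 hi.inner_lt.le) (by positivity)

variable {G} in
theorem Separates.le_of_homothety_eq {i : EuclideanSpace ℝ (Fin (k + 1)) × ℝ}
    (hi : G.Separates i v w) {y y' : EuclideanSpace ℝ (Fin (k + 1))} {t t' : ℝ}
    (hy : y ∈ G.tile v) (hy' : ⟪i.1, y'⟫_ℝ = i.2) (ht : 0 ≤ t)
    (h : AffineMap.homothety v t y = AffineMap.homothety v t' y') : t' ≤ t := by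
  have hheight := congrArg (⟪i.1, ·⟫_ℝ) h
  simp only [AffineMap.homothety_apply, vsub_eq_sub, vadd_eq_add, inner_add_right,
    real_inner_smul_right, inner_sub_right, hy', add_left_inj] at hheight
  refine le_of_mul_le_mul_right ?_ (sub_pos.2 hi.inner_lt)
  calc t' * (i.2 - ⟪i.1, v⟫_ℝ) = t * (⟪i.1, y⟫_ℝ - ⟪i.1, v⟫_ℝ) := hheight.symm
    _ ≤ t * (i.2 - ⟪i.1, v⟫_ℝ) := by gcongr; exact hi.inner_le y hy

theorem cone_inter_cone_subset (hv : v ∈ G.verts) (hw : w ∈ G.verts) (hz : z ∈ G.verts)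
    (hwv : w ≠ v) (hzv : z ≠ v) :
    G.cone w v ∩ G.cone z v ⊆ convexHull ℝ (insert v (G.facet w v ∩ G.facet z v)) := by
  have hi := G.separates_separator hv hw hwv.symm
  have hj := G.separates_separator hv hz hzv.symm
  have hconv := (G.convex_facet hw hv).inter (G.convex_facet hz hv)
  rintro x ⟨hxw, hxz⟩
  rcases (G.facet w v).eq_empty_or_nonempty with hw0 | hw0
  · rw [hw0, empty_inter]
    rwa [cone, hw0] at hxw
  rcases (G.facet z v).eq_empty_or_nonempty with hz0 | hz0
  · rw [hz0, inter_empty]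
    rwa [cone, hz0] at hxz
  obtain ⟨t, ht, y, hy, rfl⟩ := (mem_convexHull_insert_iff (G.convex_facet hw hv) hw0).1 hxw
  obtain ⟨t', ht', y', hy', heq⟩ := (mem_convexHull_insert_iff (G.convex_facet hz hv) hz0).1 hxz
  obtain rfl : t' = t := le_antisymm
    (hj.le_of_homothety_eq hy.2 (hj.inner_eq hy') ht.1 heq.symm)
    (hi.le_of_homothety_eq hy'.2 (hi.inner_eq hy) ht'.1 heq)
  rcases eq_or_ne t' 0 with rfl | ht0
  · simpa using subset_convexHull ℝ _ (mem_insert v _)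
  · obtain rfl : y' = y := by simpa [AffineMap.homothety_apply, ht0] using heq
    exact (mem_convexHull_insert_iff hconv ⟨y', hy, hy'⟩).2 ⟨t', ht, y', ⟨hy, hy'⟩, rfl⟩

theorem aedisjoint_cone (hv : v ∈ G.verts) (hw : w ∈ G.verts) (hz : z ∈ G.verts) (hwv : w ≠ v)
    (hzv : z ≠ v) (hwz : w ≠ z) : AEDisjoint volume (G.cone w v) (G.cone z v) := by
  refine measure_mono_null (G.cone_inter_cone_subset hv hw hz hwv hzv) ?_
  rw [(G.separates_separator hv hw hwv.symm).volume_convexHull_insert inter_subset_left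
    ((G.convex_facet hw hv).inter (G.convex_facet hz hv))
    ((G.isCompact_facet hw hv).inter (G.isCompact_facet hz hv)),
    G.aedisjoint_facet hv hw hz hwv hzv hwz, mul_zero]

theorem sum_volume_cone_le (hv : v ∈ G.verts) (hN : ∀ w ∈ N, w ∈ G.verts ∧ w ≠ v) :
    ∑ w ∈ N, volume.real (G.cone w v) ≤ volume.real (G.tile v) := by
  rw [← measureReal_biUnion_finset₀
    (fun w hw z hz => G.aedisjoint_cone hv (hN w hw).1 (hN z hz).1 (hN w hw).2 (hN z hz).2)
    (fun w hw => (G.isCompact_cone (hN w hw).1 hv).isClosed.measurableSet.nullMeasurableSet)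
    (fun w hw => (G.isCompact_cone (hN w hw).1 hv).measure_ne_top)]
  exact measureReal_mono (iUnion₂_subset fun w _ => G.cone_subset_tile hv)
    (G.isCompact_tile hv).measure_ne_top

theorem sum_volume_tile_le (hN : ∀ v ∈ N, v ∈ G.verts)
    {B : Set (EuclideanSpace ℝ (Fin (k + 1)))} (hB : ∀ v ∈ N, G.tile v ⊆ B)
    (hBf : volume B ≠ ⊤) : ∑ v ∈ N, volume.real (G.tile v) ≤ volume.real B := by
  rw [← measureReal_biUnion_finset₀
    (fun v hv w hw hvw => G.volume_facet (hN v hv) (hN w hw) hvw)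
    (fun v hv => (G.measurableSet_tile (hN v hv)).nullMeasurableSet)
    (fun v hv => (G.isCompact_tile (hN v hv)).measure_ne_top)]
  exact measureReal_mono (iUnion₂_subset hB) hBf

end Cones

section Conductance

variable {k : ℕ} {D : Set (EuclideanSpace ℝ (Fin (k + 1)))} (G : Tiling (k + 1) D)
  {v w : EuclideanSpace ℝ (Fin (k + 1))} {N : Finset (EuclideanSpace ℝ (Fin (k + 1)))}

theorem cond_comm (w v : EuclideanSpace ℝ (Fin (k + 1))) : G.cond w v = G.cond v w := by
  rw [cond, cond, facet_comm, norm_sub_rev]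

theorem cond_nonneg (w v : EuclideanSpace ℝ (Fin (k + 1))) : 0 ≤ G.cond w v :=
  div_nonneg measureReal_nonneg (norm_nonneg _)

theorem cond_eq_zero_of_not_adj (hw : w ∈ G.verts) (hv : v ∈ G.verts) (hadj : ¬G.Adj w v) :
    G.cond w v = 0 := by
  rcases eq_or_ne w v with rfl | hwv
  · rw [cond, sub_self, norm_zero, div_zero]
  · rw [cond, Nat.add_sub_cancel, measureReal_def, G.hausdorffMeasure_facet_eq_zero hw hv hwv hadj,
      ENNReal.toReal_zero, zero_div]

variable {G} in
theorem Adj.cond_mul_sq (hG : G.IsOrthogonal) (h : G.Adj w v) :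
    G.cond w v * ‖w - v‖ ^ 2 =
      (k + 1) * (volume.real (G.cone w v) + volume.real (G.cone v w)) := by
  have hs := G.separates_separator h.2.1 h.1 h.2.2.1.symm
  have hheight : ⟪(G.separator v w).1, w⟫_ℝ - ⟪(G.separator v w).1, v⟫_ℝ = ‖w - v‖ := by
    conv_lhs => rw [← inner_sub_right, hs.sub_eq_norm_smul hG h, real_inner_smul_right,
      real_inner_self_eq_norm_sq, hs.norm_eq_one, one_pow, mul_one]
  rw [hs.volumeReal_cone h.1 h.2.1, hs.symm.volumeReal_cone h.2.1 h.1, G.facet_comm v w, cond,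
    Nat.add_sub_cancel, Prod.fst_neg, Prod.snd_neg, inner_neg_left, ← hheight]
  have := hheight ▸ h.norm_sub_pos
  field_simp
  ring

variable {G} in
theorem Adj.volume_dualPolytope_le (hG : G.IsOrthogonal) (h : G.Adj w v) :
    volume.real (G.dualPolytope w v) ≤ G.cond w v * ‖w - v‖ ^ 2 := by
  rw [h.cond_mul_sq hG, dualPolytope_eq_cone_union_cone, add_comm (volume.real _)]
  refine (measureReal_union_le _ _).trans (le_mul_of_one_le_left (by positivity) ?_)
  exact le_add_of_nonneg_left k.cast_nonneg

theorem sum_sum_cond_mul_sq_le (hG : G.IsOrthogonal) (hN : ∀ v ∈ N, v ∈ G.verts) :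
    ∑ v ∈ N, ∑ w ∈ N, G.cond w v * ‖w - v‖ ^ 2 ≤
      2 * (k + 1) * ∑ v ∈ N, volume.real (G.tile v) := by
  classical
  have hadj {v : EuclideanSpace ℝ (Fin (k + 1))} (hv : v ∈ N) :
      ∑ w ∈ N, G.cond w v * ‖w - v‖ ^ 2 = ∑ w ∈ N with G.Adj w v,
        (k + 1) * (volume.real (G.cone w v) + volume.real (G.cone v w)) := by
    rw [← Finset.sum_filter_of_ne (p := (G.Adj · v)) fun w hw => ?_]
    · exact Finset.sum_congr rfl fun w hw => (Finset.mem_filter.1 hw).2.cond_mul_sq hG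
    · contrapose!
      intro hwv
      rw [G.cond_eq_zero_of_not_adj (hN w hw) (hN v hv) hwv, zero_mul]
  have hswap : ∑ v ∈ N, ∑ w ∈ N with G.Adj w v, volume.real (G.cone v w) =
      ∑ v ∈ N, ∑ w ∈ N with G.Adj w v, volume.real (G.cone w v) :=
    Finset.sum_comm' fun v w => by
      simp only [Finset.mem_filter]
      exact ⟨fun h => ⟨⟨h.1, h.2.2.symm⟩, h.2.1⟩, fun h => ⟨h.1.1, h.2, h.1.2.symm⟩⟩
  rw [Finset.sum_congr rfl fun v hv => hadj hv]
  simp only [← Finset.mul_sum, Finset.sum_add_distrib]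
  rw [hswap, ← two_mul, ← mul_assoc, mul_comm (k + 1 : ℝ)]
  gcongr with v hv
  refine G.sum_volume_cone_le (hN v hv) fun w hw => ?_
  obtain ⟨hwN, hwv⟩ := Finset.mem_filter.1 hw
  exact ⟨hN w hwN, hwv.2.2.1⟩

theorem sum_cond_smul_sub (hG : G.IsOrthogonal) (hv : v ∈ G.verts)
    (hvD : G.tile v ⊆ interior D) (hN : ∀ w ∈ N, w ∈ G.verts) (hNv : ∀ w, G.Adj w v → w ∈ N) :
    ∑ w ∈ N, G.cond w v • (w - v) = 0 := by
  refine ext_inner_right ℝ fun u => ?_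
  have hdiv := G.integral_tile_fderiv hG hv hvD hN hNv (φ := fun _ => 1)
    (fun _ _ => contDiffAt_const) u
  simp only [fderiv_fun_const, Pi.zero_apply, zero_apply, integral_zero, setIntegral_const,
    smul_eq_mul, mul_one] at hdiv
  rw [inner_zero_left, sum_inner, hdiv]
  refine Finset.sum_congr rfl fun w _ => ?_
  rw [real_inner_smul_left, cond, Nat.add_sub_cancel]
  ring

theorem integral_tile_laplacian (hG : G.IsOrthogonal) (hv : v ∈ G.verts)
    (hvD : G.tile v ⊆ interior D) (hN : ∀ w ∈ N, w ∈ G.verts) (hNv : ∀ w, G.Adj w v → w ∈ N)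
    {h : EuclideanSpace ℝ (Fin (k + 1)) → ℝ} (hh : ∀ x ∈ G.tile v, ContDiffAt ℝ 2 h x) :
    ∫ x in G.tile v, Laplacian.laplacian h x =
      ∑ w ∈ N, ‖w - v‖⁻¹ * ∫ y in G.facet w v, fderiv ℝ h y (w - v) ∂μHE[k] := by
  let b := EuclideanSpace.basisFun (Fin (k + 1)) ℝ
  have hfderiv : ∀ x ∈ G.tile v, ContDiffAt ℝ 1 (fderiv ℝ h) x := fun x hx =>
    (hh x hx).fderiv_right one_add_one_eq_two.le
  have hpartial (i) : ∀ x ∈ G.tile v, ContDiffAt ℝ 1 (fun y => fderiv ℝ h y (b i)) x :=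
    fun x hx => (hfderiv x hx).clm_apply contDiffAt_const
  have hInt (i) : IntegrableOn (fun x => fderiv ℝ (fun y => fderiv ℝ h y (b i)) x (b i))
      (G.tile v) :=
    ContinuousOn.integrableOn_compact (G.isCompact_tile hv) fun x hx =>
      (((hpartial i x hx).fderiv_right (m := 0) (zero_add 1).le).continuousAt.clm_apply
        continuousAt_const).continuousWithinAt
  rw [setIntegral_congr_fun (G.measurableSet_tile hv) fun x hx =>
      laplacian_eq_sum_fderiv_fderiv b ((hfderiv x hx).differentiableAt one_ne_zero),
    integral_finsetSum _ fun i _ => hInt i,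
    Finset.sum_congr rfl fun i _ => G.integral_tile_fderiv hG hv hvD hN hNv (hpartial i) (b i),
    Finset.sum_comm]
  refine Finset.sum_congr rfl fun w hw => ?_
  rcases eq_or_ne w v with rfl | hwv
  · simp
  have hfacet (i) : IntegrableOn (fun y => fderiv ℝ h y (b i)) (G.facet w v) μHE[k] :=
    G.integrableOn_facet (hN w hw) hv hwv fun x hx =>
      (hpartial i x hx.2).continuousAt.continuousWithinAt
  have hexpand (y) : fderiv ℝ h y (w - v) = ∑ i, ⟪w - v, b i⟫_ℝ * fderiv ℝ h y (b i) :=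
    apply_eq_sum_inner_mul b (fderiv ℝ h y : _ →ₗ[ℝ] ℝ) (w - v)
  simp only [hexpand]
  rw [integral_finsetSum _ fun i _ => (hfacet i).const_mul _, Finset.mul_sum]
  exact Finset.sum_congr rfl fun i _ => by rw [integral_const_mul, mul_assoc]

end Conductance

end Tiling

section Taylor

variable {E F : Type*} [NormedAddCommGroup E] [NormedSpace ℝ E] [NormedAddCommGroup F]
  [NormedSpace ℝ F]

theorem norm_sub_sub_fderiv_le_of_norm_iteratedFDeriv_le {h : E → F} {S : Set E}
    (hS : Convex ℝ S) (hh : ∀ x ∈ S, ContDiffAt ℝ 2 h x) {M r : ℝ}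
    (hM : ∀ x ∈ S, ‖iteratedFDeriv ℝ 2 h x‖ ≤ M) {p q y : E} (hp : p ∈ S) (hq : q ∈ S)
    (hy : y ∈ S) (hpr : ‖p - y‖ ≤ r) (hqr : ‖q - y‖ ≤ r) :
    ‖h q - h p - fderiv ℝ h y (q - p)‖ ≤ M * r * ‖q - p‖ := by
  have hM0 : 0 ≤ M := (norm_nonneg _).trans (hM y hy)
  have hlip (x) (hx : x ∈ S) : ‖fderiv ℝ h x - fderiv ℝ h y‖ ≤ M * ‖x - y‖ := by
    refine hS.norm_image_sub_le_of_norm_fderiv_le (𝕜 := ℝ) (f := fderiv ℝ h)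
      (fun z hz => ?_) (fun z hz => ?_) hy hx
    · exact ((hh z hz).fderiv_right one_add_one_eq_two.le).differentiableAt one_ne_zero
    · rw [← norm_iteratedFDeriv_one, norm_iteratedFDeriv_fderiv]
      exact hM z hz
  have hball : segment ℝ p q ⊆ Metric.closedBall y r :=
    (convex_closedBall y r).segment_subset (mem_closedBall_iff_norm.2 hpr)
      (mem_closedBall_iff_norm.2 hqr)
  have hseg := hS.segment_subset hp hq
  refine (convex_segment p q).norm_image_sub_le_of_norm_fderiv_le'
    (fun x hx => (hh x (hseg hx)).differentiableAt two_ne_zero)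
    (fun x hx => (hlip x (hseg hx)).trans ?_) (left_mem_segment ℝ p q) (right_mem_segment ℝ p q)
  exact mul_le_mul_of_nonneg_left (mem_closedBall_iff_norm.1 (hball hx)) hM0

theorem norm_iteratedFDeriv_le_hessianBound {d : ℕ} {K : Set (EuclideanSpace ℝ (Fin d))}
    (hK : IsCompact K) {h : EuclideanSpace ℝ (Fin d) → ℝ} (hh : ∀ x ∈ K, ContDiffAt ℝ 2 h x)
    {x : EuclideanSpace ℝ (Fin d)} (hx : x ∈ K) :
    ‖iteratedFDeriv ℝ 2 h x‖ ≤ hessianBound h K := by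
  have hcont : ContinuousOn (fun x => ‖iteratedFDeriv ℝ 2 h x‖) K := fun y hy =>
    ((hh y hy).continuousAt_iteratedFDeriv le_rfl).norm.continuousWithinAt
  exact (le_csSup (hK.bddAbove_image hcont) (mem_image_of_mem _ hx)).trans (le_max_left _ _)

end Taylor

namespace Tiling

section Domain

variable {d : ℕ} {D : Set (EuclideanSpace ℝ (Fin d))} (G : Tiling d D)
  {v w : EuclideanSpace ℝ (Fin d)} {U : Set (EuclideanSpace ℝ (Fin d))}

theorem norm_sub_le_diam (hv : v ∈ G.verts) {x y : EuclideanSpace ℝ (Fin d)}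
    (hx : x ∈ G.tile v) (hy : y ∈ G.tile v) : ‖x - y‖ ≤ Metric.diam (G.tile v) := by
  rw [← dist_eq_norm]
  exact Metric.dist_le_diam_of_mem (G.isCompact_tile hv).isBounded hx hy

theorem diam_tile_pos [Nontrivial (EuclideanSpace ℝ (Fin d))] (hv : v ∈ G.verts) :
    0 < Metric.diam (G.tile v) := by
  have := Module.punctured_nhds_neBot ℝ (EuclideanSpace ℝ (Fin d)) v
  exact Metric.diam_pos
    (infinite_of_mem_nhds v (mem_interior_iff_mem_nhds.1 (G.mem_interior v hv))).nontrivial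
    (G.isCompact_tile hv).isBounded

variable {G} in
theorem mem_verts_of_mem_closedVerts (hv : v ∈ G.closedVerts U) : v ∈ G.verts := by
  rcases hv with hv | ⟨-, z, -, hz⟩
  · exact hv.1
  · exact hz.1

variable {G} in
theorem Adj.mem_closedVerts (h : G.Adj w v) (hv : v ∈ G.vertsIn U) : w ∈ G.closedVerts U := by
  by_cases hw : w ∈ G.vertsIn U
  · exact Or.inl hw
  · exact Or.inr ⟨hw, v, hv, h⟩

theorem finite_vertsIn (hUb : Bornology.IsBounded U) (hUD : closure U ⊆ D) :
    (G.vertsIn U).Finite :=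
  (G.locallyFinite _ hUD hUb.isCompact_closure).subset fun v hv =>
    ⟨hv.1, v, G.mem_tile hv.1, subset_closure (interior_subset hv.2)⟩

theorem finite_closedVerts (hUb : Bornology.IsBounded U) (hUD : closure U ⊆ D)
    (hUi : ∀ v ∈ G.vertsIn U, G.tile v ⊆ interior D) : (G.closedVerts U).Finite := by
  have hfin := G.finite_vertsIn hUb hUD
  refine hfin.union ((hfin.biUnion fun v hv =>
    G.finite_touching hv.1 ((hUi v hv).trans interior_subset)).subset ?_)
  rintro w ⟨-, v, hv, h⟩
  exact mem_biUnion hv h.mem_touching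

theorem tile_subset_hat (hv : v ∈ G.closedVerts U) : G.tile v ⊆ G.hat U :=
  subset_biUnion_of_mem (u := G.tile) hv

theorem tile_subset_hatHull (hv : v ∈ G.closedVerts U) : G.tile v ⊆ G.hatHull U :=
  (G.tile_subset_hat hv).trans subset_union_left

variable {G} in
theorem Adj.convexHull_dualPolytope_subset_hatHull (h : G.Adj w v) (hw : w ∈ G.vertsIn U)
    (hv : v ∈ G.vertsIn U) : convexHull ℝ (G.dualPolytope w v) ⊆ G.hatHull U :=
  subset_union_of_subset_right (fun x hx => by
    simp only [mem_iUnion]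
    exact ⟨w, hw, v, hv, h, hx⟩) _

variable {G} in
theorem Adj.isCompact_convexHull_dualPolytope (h : G.Adj w v) :
    IsCompact (convexHull ℝ (G.dualPolytope w v)) := by
  have hcone (p) := isCompact_convexHull_insert (G.isCompact_facet h.1 h.2.1)
    (G.convex_facet h.1 h.2.1) p
  rw [dualPolytope, convexHull_union (insert_nonempty _ _).convexHull
    (insert_nonempty _ _).convexHull, (convex_convexHull ℝ _).convexHull_eq,
    (convex_convexHull ℝ _).convexHull_eq]
  exact isCompact_convexJoin (hcone w) (hcone v)

theorem isCompact_hatHull (hfin : (G.closedVerts U).Finite) : IsCompact (G.hatHull U) := by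
  have hfin' : (G.vertsIn U).Finite := hfin.subset subset_union_left
  refine (hfin.isCompact_biUnion fun v hv =>
    G.isCompact_tile (mem_verts_of_mem_closedVerts hv)).union
    (hfin'.isCompact_biUnion fun w _ => hfin'.isCompact_biUnion fun v _ => ?_)
  by_cases h : G.Adj w v
  · simpa [h] using h.isCompact_convexHull_dualPolytope
  · simp [h]

theorem diam_tile_le_mesh (hfin : (G.closedVerts U).Finite) (hv : v ∈ G.closedVerts U) :
    Metric.diam (G.tile v) ≤ G.mesh U :=
  le_csSup (hfin.image _).bddAbove (mem_image_of_mem _ hv)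

theorem mesh_nonneg : 0 ≤ G.mesh U :=
  Real.sSup_nonneg (by rintro _ ⟨v, -, rfl⟩; exact Metric.diam_nonneg)

theorem norm_le_add_two_mul_mesh {R : ℝ} (hU : U ⊆ Metric.closedBall 0 R)
    (hfin : (G.closedVerts U).Finite) (hv : v ∈ G.closedVerts U) : ‖v‖ ≤ R + 2 * G.mesh U := by
  have hin (w) (hw : w ∈ G.vertsIn U) : ‖w‖ ≤ R :=
    mem_closedBall_zero_iff.1 (hU (interior_subset hw.2))
  rcases hv with hv | ⟨-, w, hw, hadj⟩
  · linarith [hin v hv, G.mesh_nonneg (U := U)]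
  · obtain ⟨y, hyv, hyw⟩ := hadj.2.2.2.1
    have hvy := (G.norm_sub_le_diam hadj.1 (G.mem_tile hadj.1) hyv).trans
      (G.diam_tile_le_mesh hfin (hadj.mem_closedVerts hw))
    have hyw := (G.norm_sub_le_diam hw.1 hyw (G.mem_tile hw.1)).trans
      (G.diam_tile_le_mesh hfin (Or.inl hw))
    calc ‖v‖ = ‖(v - y) + (y - w) + w‖ := by rw [sub_add_sub_cancel, sub_add_cancel]
      _ ≤ ‖v - y‖ + ‖y - w‖ + ‖w‖ := norm_add₃_le
      _ ≤ R + 2 * G.mesh U := by linarith [hin w hw]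

theorem tile_subset_closedBall {R : ℝ} (hU : U ⊆ Metric.closedBall 0 R)
    (hfin : (G.closedVerts U).Finite) (hv : v ∈ G.closedVerts U) :
    G.tile v ⊆ Metric.closedBall 0 (R + 3 * G.mesh U) := fun x hx => by
  have hverts := mem_verts_of_mem_closedVerts hv
  have hxv := (G.norm_sub_le_diam hverts hx (G.mem_tile hverts)).trans
    (G.diam_tile_le_mesh hfin hv)
  rw [mem_closedBall_zero_iff]
  linarith [norm_sub_norm_le x v, G.norm_le_add_two_mul_mesh hU hfin hv]

end Domain

section FlowError

variable {k : ℕ} {D : Set (EuclideanSpace ℝ (Fin (k + 1)))} (G : Tiling (k + 1) D)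
  {v w : EuclideanSpace ℝ (Fin (k + 1))} {N : Finset (EuclideanSpace ℝ (Fin (k + 1)))}
  {h : EuclideanSpace ℝ (Fin (k + 1)) → ℝ} {M ε : ℝ}

theorem discreteLaplacian_eq_sum (hv : v ∈ G.verts) (hN : ∀ w ∈ N, w ∈ G.verts)
    (hNv : ∀ w, G.Adj w v → w ∈ N) (h : EuclideanSpace ℝ (Fin (k + 1)) → ℝ) :
    G.discreteLaplacian h v = ∑ w ∈ N, G.cond w v * (h w - h v) := by
  refine finsum_mem_eq_sum_of_inter_support_eq _ (Set.ext fun w => ?_)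
  simp only [mem_inter_iff, mem_ofPred_eq, Function.mem_support, Finset.mem_coe,
    and_congr_left_iff]
  refine fun hne => ⟨hNv w, fun hw => ?_⟩
  contrapose! hne
  rw [G.cond_eq_zero_of_not_adj (hN w hw) hv hne, zero_mul]

/-- The difference between the discrete flow `a(w, v) (h w - h v)` and the flux of `∇ h` through
the facet of the edge `(w, v)`. -/
noncomputable def flowError (h : EuclideanSpace ℝ (Fin (k + 1)) → ℝ)
    (w v : EuclideanSpace ℝ (Fin (k + 1))) : ℝ :=
  G.cond w v * (h w - h v) -
    ‖w - v‖⁻¹ * ∫ y in G.facet w v, fderiv ℝ h y (w - v) ∂μHE[k]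

theorem flowError_antisymm (h : EuclideanSpace ℝ (Fin (k + 1)) → ℝ)
    (w v : EuclideanSpace ℝ (Fin (k + 1))) : G.flowError h w v = -G.flowError h v w := by
  have hflux : ∫ y in G.facet v w, fderiv ℝ h y (w - v) ∂μHE[k] =
      -∫ y in G.facet v w, fderiv ℝ h y (v - w) ∂μHE[k] := by
    simp only [← integral_neg, ← map_neg, neg_sub]
  rw [flowError, flowError, facet_comm, hflux, norm_sub_rev, cond_comm]
  ring

theorem sum_flowError (hG : G.IsOrthogonal) (hv : v ∈ G.verts) (hvD : G.tile v ⊆ interior D)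
    (hN : ∀ w ∈ N, w ∈ G.verts) (hNv : ∀ w, G.Adj w v → w ∈ N)
    (hh : ∀ x ∈ G.tile v, ContDiffAt ℝ 2 h x) :
    ∑ w ∈ N, G.flowError h w v =
      G.discreteLaplacian h v - ∫ x in G.tile v, Laplacian.laplacian h x := by
  rw [G.discreteLaplacian_eq_sum hv hN hNv, G.integral_tile_laplacian hG hv hvD hN hNv hh,
    ← Finset.sum_sub_distrib]
  rfl

theorem flowError_eq_zero_of_not_adj (hw : w ∈ G.verts) (hv : v ∈ G.verts)
    (hadj : ¬G.Adj w v) : G.flowError h w v = 0 := by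
  rw [flowError, G.cond_eq_zero_of_not_adj hw hv hadj]
  rcases eq_or_ne w v with rfl | hwv
  · simp
  · rw [setIntegral_measure_zero _ (G.hausdorffMeasure_facet_eq_zero hw hv hwv hadj)]
    simp

variable {G} in
theorem Adj.flowError_eq_setIntegral (hadj : G.Adj w v)
    (hh : ∀ y ∈ G.facet w v, ContDiffAt ℝ 2 h y) :
    G.flowError h w v =
      ‖w - v‖⁻¹ * ∫ y in G.facet w v, (h w - h v - fderiv ℝ h y (w - v)) ∂μHE[k] := by
  have hconst : IntegrableOn (fun _ => h w - h v) (G.facet w v) μHE[k] :=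
    G.integrableOn_facet hadj.1 hadj.2.1 hadj.2.2.1 continuousOn_const
  have hfderiv : IntegrableOn (fun y => fderiv ℝ h y (w - v)) (G.facet w v) μHE[k] :=
    G.integrableOn_facet hadj.1 hadj.2.1 hadj.2.2.1 fun y hy =>
      (((hh y hy).fderiv_right (m := 1) one_add_one_eq_two.le).continuousAt.clm_apply
        continuousAt_const).continuousWithinAt
  rw [integral_sub hconst hfderiv, setIntegral_const, smul_eq_mul, flowError, cond,
    Nat.add_sub_cancel]
  ring

variable {G} in
theorem Adj.abs_flowError_le_of_forall_abs_le (hadj : G.Adj w v)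
    (hh : ∀ y ∈ G.facet w v, ContDiffAt ℝ 2 h y) {B : ℝ}
    (hB : ∀ y ∈ G.facet w v, |h w - h v - fderiv ℝ h y (w - v)| ≤ B) :
    |G.flowError h w v| ≤ G.cond w v * B := by
  rw [hadj.flowError_eq_setIntegral hh, abs_mul, abs_inv, abs_norm, cond, Nat.add_sub_cancel,
    div_mul_eq_mul_div, inv_mul_eq_div, mul_comm _ B]
  gcongr
  exact norm_setIntegral_le_of_norm_le_const (f := fun y => h w - h v - fderiv ℝ h y (w - v))
    (G.hausdorffMeasure_facet_ne_top hadj.1 hadj.2.1 hadj.2.2.1).lt_top hB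

variable {G} in
theorem Adj.abs_flowError_le_mul_max_diam (hadj : G.Adj w v)
    (hh : ∀ x ∈ convexHull ℝ (G.dualPolytope w v), ContDiffAt ℝ 2 h x)
    (hM : ∀ x ∈ convexHull ℝ (G.dualPolytope w v), ‖iteratedFDeriv ℝ 2 h x‖ ≤ M) :
    |G.flowError h w v| ≤
      G.cond w v * ‖w - v‖ * (M * max (Metric.diam (G.tile w)) (Metric.diam (G.tile v))) := by
  have hQ : insert w (G.facet w v) ∪ insert v (G.facet w v) ⊆
      convexHull ℝ (G.dualPolytope w v) :=
    (union_subset_union (subset_convexHull ℝ _) (subset_convexHull ℝ _)).trans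
      (subset_convexHull ℝ _)
  rw [mul_assoc, mul_comm ‖w - v‖]
  refine hadj.abs_flowError_le_of_forall_abs_le
    (fun y hy => hh y (hQ (Or.inl (Or.inr hy)))) fun y hy => ?_
  exact norm_sub_sub_fderiv_le_of_norm_iteratedFDeriv_le (convex_convexHull ℝ _) hh hM
    (hQ (Or.inr (mem_insert _ _))) (hQ (Or.inl (mem_insert _ _))) (hQ (Or.inl (Or.inr hy)))
    ((G.norm_sub_le_diam hadj.2.1 (G.mem_tile hadj.2.1) hy.2).trans (le_max_right _ _))
    ((G.norm_sub_le_diam hadj.1 (G.mem_tile hadj.1) hy.1).trans (le_max_left _ _))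

theorem abs_sub_sub_fderiv_le_of_mem_tile (hv : v ∈ G.verts)
    (hh : ∀ x ∈ G.tile v, ContDiffAt ℝ 2 h x)
    (hM : ∀ x ∈ G.tile v, ‖iteratedFDeriv ℝ 2 h x‖ ≤ M) (hε : Metric.diam (G.tile v) ≤ ε)
    {y : EuclideanSpace ℝ (Fin (k + 1))} (hy : y ∈ G.tile v) :
    |h v - h y - fderiv ℝ h y (v - y)| ≤ M * ε ^ 2 := by
  have hM0 : 0 ≤ M := (norm_nonneg _).trans (hM y hy)
  have hε0 : 0 ≤ ε := Metric.diam_nonneg.trans hε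
  have hvy : ‖v - y‖ ≤ ε := (G.norm_sub_le_diam hv (G.mem_tile hv) hy).trans hε
  calc |h v - h y - fderiv ℝ h y (v - y)| ≤ M * ε * ‖v - y‖ :=
        norm_sub_sub_fderiv_le_of_norm_iteratedFDeriv_le (G.convex_tile hv) hh hM hy
          (G.mem_tile hv) hy (by rwa [sub_self, norm_zero]) hvy
    _ ≤ M * ε * ε := by gcongr
    _ = M * ε ^ 2 := by ring

variable {G} in
/-- The segment from `w` to `v` may leave the domain of `h`, so we compare both values with the one
at a point of the facet. -/
theorem Adj.abs_flowError_le_mul_sq (hadj : G.Adj w v)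
    (hh : ∀ x ∈ G.tile w ∪ G.tile v, ContDiffAt ℝ 2 h x)
    (hM : ∀ x ∈ G.tile w ∪ G.tile v, ‖iteratedFDeriv ℝ 2 h x‖ ≤ M)
    (hεw : Metric.diam (G.tile w) ≤ ε) (hεv : Metric.diam (G.tile v) ≤ ε) :
    |G.flowError h w v| ≤ G.cond w v * (2 * (M * ε ^ 2)) := by
  refine hadj.abs_flowError_le_of_forall_abs_le (fun y hy => hh y (Or.inl hy.1)) fun y hy => ?_
  have hw := G.abs_sub_sub_fderiv_le_of_mem_tile hadj.1 (fun x hx => hh x (Or.inl hx))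
    (fun x hx => hM x (Or.inl hx)) hεw hy.1
  have hv := G.abs_sub_sub_fderiv_le_of_mem_tile hadj.2.1 (fun x hx => hh x (Or.inr hx))
    (fun x hx => hM x (Or.inr hx)) hεv hy.2
  calc |h w - h v - fderiv ℝ h y (w - v)|
      = |(h w - h y - fderiv ℝ h y (w - y)) - (h v - h y - fderiv ℝ h y (v - y))| := by
        simp only [map_sub]
        ring_nf
    _ ≤ M * ε ^ 2 + M * ε ^ 2 := (abs_sub _ _).trans (add_le_add hw hv)
    _ = 2 * (M * ε ^ 2) := (two_mul _).symm

end FlowError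

section Network

variable {k : ℕ} {D : Set (EuclideanSpace ℝ (Fin (k + 1)))} (G : Tiling (k + 1) D)
  (U : Set (EuclideanSpace ℝ (Fin (k + 1)))) [Fintype (G.closedVerts U)]

/-- The conductances of the finite network on `𝒱[U] ∪ ∂𝒱[U]`. -/
noncomputable def networkCond (w v : G.closedVerts U) : ℝ :=
  G.cond w v

open Classical in
/-- The vertices `𝒱[U]` of the finite network on `𝒱[U] ∪ ∂𝒱[U]`. -/
noncomputable def networkInterior : Finset (G.closedVerts U) :=
  Finset.univ.filter fun v => v.1 ∈ G.vertsIn U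

variable {G U}

theorem mem_networkInterior {v : G.closedVerts U} :
    v ∈ G.networkInterior U ↔ v.1 ∈ G.vertsIn U := by
  simp [networkInterior]

theorem mem_verts_of_mem_toFinset {v : EuclideanSpace ℝ (Fin (k + 1))}
    (hv : v ∈ (G.closedVerts U).toFinset) : v ∈ G.verts :=
  mem_verts_of_mem_closedVerts (mem_toFinset.1 hv)

theorem Adj.mem_toFinset_closedVerts {v w : EuclideanSpace ℝ (Fin (k + 1))} (hadj : G.Adj w v)
    (hv : v ∈ G.vertsIn U) : w ∈ (G.closedVerts U).toFinset :=
  mem_toFinset.2 (hadj.mem_closedVerts hv)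

omit [Fintype (G.closedVerts U)] in
theorem networkCond_nonneg (v w : G.closedVerts U) : 0 ≤ G.networkCond U v w :=
  G.cond_nonneg _ _

theorem networkLaplacian_networkCond (h : EuclideanSpace ℝ (Fin (k + 1)) → ℝ)
    {v : G.closedVerts U} (hv : v ∈ G.networkInterior U) :
    networkLaplacian (G.networkCond U) (fun w => h w) v = G.discreteLaplacian h v := by
  rw [mem_networkInterior] at hv
  rw [G.discreteLaplacian_eq_sum hv.1 (fun _ => mem_verts_of_mem_toFinset)
    (fun _ hw => hw.mem_toFinset_closedVerts hv), networkLaplacian_apply,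
    ← Finset.sum_set_coe (G.closedVerts U) (f := fun w => G.cond w v * (h w - h v))]
  rfl

theorem speedMeasure_networkCond (v : G.closedVerts U) :
    speedMeasure (G.networkCond U) Subtype.val v =
      ∑ w ∈ (G.closedVerts U).toFinset, G.cond w v * ‖w - v.1‖ ^ 2 :=
  Finset.sum_set_coe (G.closedVerts U) (f := fun w => G.cond w v * ‖w - v.1‖ ^ 2)

theorem maxDualVolume_le_speedMeasure_rpow (hG : G.IsOrthogonal) {α : ℝ} (hα : 0 ≤ α)
    {v : G.closedVerts U} (hv : v ∈ G.networkInterior U) :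
    G.maxDualVolume α v ≤ speedMeasure (G.networkCond U) Subtype.val v ^ α := by
  rw [mem_networkInterior] at hv
  refine Real.sSup_le ?_ (Real.rpow_nonneg (speedMeasure_nonneg networkCond_nonneg _ _)
    _)
  rintro _ ⟨w, hw, rfl⟩
  have hvol : volume.real (G.dualPolytope w v) ≤ speedMeasure (G.networkCond U) Subtype.val v := by
    rw [speedMeasure_networkCond]
    exact (Adj.volume_dualPolytope_le hG hw).trans (Finset.single_le_sum
      (f := fun w => G.cond w v * ‖w - v.1‖ ^ 2)
      (fun w _ => mul_nonneg (G.cond_nonneg _ _) (sq_nonneg _))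
      (Adj.mem_toFinset_closedVerts hw hv))
  exact Real.rpow_le_rpow measureReal_nonneg hvol hα

theorem diam_tile_le_mul_speedMeasure_rpow (hG : G.IsOrthogonal) {F α : ℝ} (hF : 0 ≤ F)
    (hα : 0 ≤ α) (hdiam : ∀ v ∈ G.vertsIn U, Metric.diam (G.tile v) ≤ F * G.maxDualVolume α v)
    {v : G.closedVerts U} (hv : v ∈ G.networkInterior U) :
    Metric.diam (G.tile v) ≤ F * speedMeasure (G.networkCond U) Subtype.val v ^ α :=
  (hdiam v (mem_networkInterior.1 hv)).trans
    (mul_le_mul_of_nonneg_left (maxDualVolume_le_speedMeasure_rpow hG hα hv) hF)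

theorem isBalancedNetwork_networkCond (hG : G.IsOrthogonal)
    (hUi : ∀ v ∈ G.vertsIn U, G.tile v ⊆ interior D)
    {F α R : ℝ} (hF : 0 ≤ F) (hα : 0 < α)
    (hdiam : ∀ v ∈ G.vertsIn U, Metric.diam (G.tile v) ≤ F * G.maxDualVolume α v)
    (hR : ∀ v ∈ G.closedVerts U, ‖v‖ ≤ R) :
    IsBalancedNetwork (G.networkCond U) Subtype.val (G.networkInterior U) R where
  symm _ _ := G.cond_comm _ _
  nonneg := networkCond_nonneg
  norm_le v := hR v v.2
  sum_smul_sub_eq_zero v hv := by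
    rw [mem_networkInterior] at hv
    rw [← G.sum_cond_smul_sub hG hv.1 (hUi _ hv) (fun _ => mem_verts_of_mem_toFinset)
      (fun _ hw => hw.mem_toFinset_closedVerts hv),
      ← Finset.sum_set_coe (G.closedVerts U) (f := fun w => G.cond w v • (w - v.1))]
    rfl
  speedMeasure_pos v hv := by
    have hpos := (G.diam_tile_pos (mem_verts_of_mem_closedVerts v.2)).trans_le
      (diam_tile_le_mul_speedMeasure_rpow hG hF hα.le hdiam hv)
    refine (speedMeasure_nonneg networkCond_nonneg _ _).lt_of_ne' fun h0 => ?_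
    rw [h0, Real.zero_rpow hα.ne', mul_zero] at hpos
    exact hpos.false

theorem sum_speedMeasure_le (hG : G.IsOrthogonal) {B : Set (EuclideanSpace ℝ (Fin (k + 1)))}
    (hB : ∀ v ∈ G.closedVerts U, G.tile v ⊆ B) (hBf : volume B ≠ ⊤) :
    ∑ v ∈ G.networkInterior U, speedMeasure (G.networkCond U) Subtype.val v ≤
      2 * (k + 1) * volume.real B := by
  calc ∑ v ∈ G.networkInterior U, speedMeasure (G.networkCond U) Subtype.val v
      ≤ ∑ v, speedMeasure (G.networkCond U) Subtype.val v :=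
        Finset.sum_le_univ_sum_of_nonneg
          (speedMeasure_nonneg networkCond_nonneg _)
    _ = ∑ v ∈ (G.closedVerts U).toFinset, ∑ w ∈ (G.closedVerts U).toFinset,
          G.cond w v * ‖w - v‖ ^ 2 := by
        simp only [speedMeasure_networkCond]
        exact Finset.sum_set_coe (G.closedVerts U)
          (f := fun v => ∑ w ∈ (G.closedVerts U).toFinset, G.cond w v * ‖w - v‖ ^ 2)
    _ ≤ 2 * (k + 1) * ∑ v ∈ (G.closedVerts U).toFinset, volume.real (G.tile v) :=
        G.sum_sum_cond_mul_sq_le hG fun _ => mem_verts_of_mem_toFinset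
    _ ≤ 2 * (k + 1) * volume.real B := by
        gcongr
        exact G.sum_volume_tile_le (fun _ => mem_verts_of_mem_toFinset)
          (fun v hv => hB v (mem_toFinset.1 hv)) hBf

variable {h : EuclideanSpace ℝ (Fin (k + 1)) → ℝ}

theorem networkLaplacian_sub_eq_sum_flowError (hG : G.IsOrthogonal)
    (hUi : ∀ v ∈ G.vertsIn U, G.tile v ⊆ interior D)
    (hh : ∀ x ∈ G.hat U, ContDiffAt ℝ 2 h x) (hΔ : ∀ x ∈ G.hat U, Laplacian.laplacian h x = 0)
    {v : G.closedVerts U} (hv : v ∈ G.networkInterior U)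
    {u : EuclideanSpace ℝ (Fin (k + 1)) → ℝ} (hu : G.discreteLaplacian u v = 0) :
    networkLaplacian (G.networkCond U) (fun w => h w - u w) v =
      ∑ w : G.closedVerts U, G.flowError h w v := by
  have hsub : networkLaplacian (G.networkCond U) (fun w => h w - u w) v =
      G.discreteLaplacian h v - G.discreteLaplacian u v := by
    rw [← networkLaplacian_networkCond h hv, ← networkLaplacian_networkCond u hv]
    exact congrFun (map_sub (networkLaplacian (G.networkCond U)) _ _) v
  rw [mem_networkInterior] at hv
  have hsum := G.sum_flowError hG hv.1 (hUi _ hv) (fun _ => mem_verts_of_mem_toFinset)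
    (fun _ hw => hw.mem_toFinset_closedVerts hv) fun x hx => hh x (G.tile_subset_hat v.2 hx)
  rw [setIntegral_eq_zero_of_forall_eq_zero fun x hx => hΔ x (G.tile_subset_hat v.2 hx),
    sub_zero, ← Finset.sum_set_coe (G.closedVerts U) (f := fun w => G.flowError h w v)] at hsum
  rw [hsub, hu, sub_zero, hsum]

omit [Fintype (G.closedVerts U)] in
theorem abs_flowError_le_of_mem_vertsIn {v w : EuclideanSpace ℝ (Fin (k + 1))}
    (hfin : (G.closedVerts U).Finite)
    (hh : ∀ x ∈ G.hatHull U, ContDiffAt ℝ 2 h x) (hw : w ∈ G.vertsIn U) (hv : v ∈ G.vertsIn U) :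
    |G.flowError h w v| ≤ G.cond w v * ‖w - v‖ * (hessianBound h (G.hatHull U) *
      max (Metric.diam (G.tile w)) (Metric.diam (G.tile v))) := by
  by_cases hadj : G.Adj w v
  · have hsub := hadj.convexHull_dualPolytope_subset_hatHull hw hv
    exact hadj.abs_flowError_le_mul_max_diam (fun x hx => hh x (hsub hx)) fun x hx =>
      norm_iteratedFDeriv_le_hessianBound (G.isCompact_hatHull hfin) hh (hsub hx)
  · simp [G.flowError_eq_zero_of_not_adj hw.1 hv.1 hadj,
      G.cond_eq_zero_of_not_adj hw.1 hv.1 hadj]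

omit [Fintype (G.closedVerts U)] in
theorem abs_flowError_le_of_mem_closedVerts {v w : EuclideanSpace ℝ (Fin (k + 1))}
    (hfin : (G.closedVerts U).Finite)
    (hh : ∀ x ∈ G.hatHull U, ContDiffAt ℝ 2 h x) (hw : w ∈ G.closedVerts U)
    (hv : v ∈ G.closedVerts U) :
    |G.flowError h w v| ≤
      G.cond w v * (2 * (hessianBound h (G.hatHull U) * G.mesh U ^ 2)) := by
  have hw' := mem_verts_of_mem_closedVerts hw
  have hv' := mem_verts_of_mem_closedVerts hv
  by_cases hadj : G.Adj w v
  · have hsub : G.tile w ∪ G.tile v ⊆ G.hatHull U :=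
      union_subset (G.tile_subset_hatHull hw) (G.tile_subset_hatHull hv)
    exact hadj.abs_flowError_le_mul_sq (fun x hx => hh x (hsub hx))
      (fun x hx => norm_iteratedFDeriv_le_hessianBound (G.isCompact_hatHull hfin) hh (hsub hx))
      (G.diam_tile_le_mesh hfin hw) (G.diam_tile_le_mesh hfin hv)
  · simp [G.flowError_eq_zero_of_not_adj hw' hv' hadj, G.cond_eq_zero_of_not_adj hw' hv' hadj]

end Network

theorem abs_sub_le_supBoundConstant_mul {k : ℕ} {D U : Set (EuclideanSpace ℝ (Fin (k + 1)))}
    {G : Tiling (k + 1) D} (hG : G.IsOrthogonal) {F α R L : ℝ} (hF : 0 ≤ F) (hα : 0 < α)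
    (hU : U ⊆ Metric.closedBall 0 R) (hUD : closure U ⊆ D)
    (hUi : ∀ v ∈ G.vertsIn U, G.tile v ⊆ interior D)
    (hdiam : ∀ v ∈ G.vertsIn U, Metric.diam (G.tile v) ≤ F * G.maxDualVolume α v)
    (hL : 1 ≤ L) (hLα : 2 * α ≤ L) (hLmesh : G.mesh U = Real.exp (-L))
    {hC hD : EuclideanSpace ℝ (Fin (k + 1)) → ℝ}
    (hC2 : ∀ x ∈ G.hatHull U, ContDiffAt ℝ 2 hC x)
    (hΔ : ∀ x ∈ G.hat U, Laplacian.laplacian hC x = 0)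
    (hDΔ : ∀ v ∈ G.vertsIn U, G.discreteLaplacian hD v = 0)
    (hbd : ∀ v ∈ G.bdryVerts U, hD v = hC v) {z : EuclideanSpace ℝ (Fin (k + 1))}
    (hz : z ∈ G.vertsIn U) :
    |hD z - hC z| ≤ supBoundConstant (2 * (k + 1) * volume.real
        (Metric.closedBall (0 : EuclideanSpace ℝ (Fin (k + 1))) (R + 2))) (R + 1) F α *
      hessianBound hC (G.hatHull U) * (Real.exp (-L) * L) := by
  have hfin := G.finite_closedVerts (Metric.isBounded_closedBall.subset hU) hUD hUi
  have := hfin.fintype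
  have hmesh : 2 * G.mesh U ≤ 1 := by
    have : Real.exp (-L) ≤ Real.exp (-1) := Real.exp_le_exp.2 (neg_le_neg hL)
    linarith [Real.exp_neg_one_lt_half]
  have hN : IsBalancedNetwork (G.networkCond U) Subtype.val (G.networkInterior U) (R + 1) :=
    isBalancedNetwork_networkCond hG hUi hF hα hdiam fun v hv => by
      linarith [G.norm_le_add_two_mul_mesh hU hfin hv]
  have hA := sum_speedMeasure_le hG (U := U) (B := Metric.closedBall 0 (R + 2))
    (fun v hv => (G.tile_subset_closedBall hU hfin hv).trans
      (Metric.closedBall_subset_closedBall (by linarith [G.mesh_nonneg (U := U)])))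
    measure_closedBall_lt_top.ne
  have hM : 0 ≤ hessianBound hC (G.hatHull U) := zero_le_one.trans (le_max_right _ _)
  rw [abs_sub_comm]
  refine hN.abs_le_supBoundConstant_mul (f := fun v : G.closedVerts U => hC v - hD v)
    (r := fun v : G.closedVerts U => Metric.diam (G.tile v))
    (θ := fun w v : G.closedVerts U => G.flowError hC w v)
    (z := ⟨z, Or.inl hz⟩) hA hF hα hL hLα hM (fun _ _ => Metric.diam_nonneg)
    (fun v _ => hLmesh ▸ G.diam_tile_le_mesh hfin v.2)
    (fun v hv => diam_tile_le_mul_speedMeasure_rpow hG hF hα.le hdiam hv) (fun v hv => ?_)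
    (fun v hv => ?_) (fun v _ w _ => G.flowError_antisymm _ _ _) (fun v hv w hw => ?_)
    (fun v _ w _ => ?_) (mem_networkInterior.2 hz)
  · rw [mem_networkInterior] at hv
    rw [hbd v (v.2.resolve_left hv), sub_self]
  · exact networkLaplacian_sub_eq_sum_flowError hG hUi (fun x hx => hC2 x (Or.inl hx)) hΔ hv
      (hDΔ v (mem_networkInterior.1 hv))
  · exact abs_flowError_le_of_mem_vertsIn hfin hC2 (mem_networkInterior.1 hw)
      (mem_networkInterior.1 hv)
  · refine (abs_flowError_le_of_mem_closedVerts hfin hC2 w.2 v.2).trans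
      (mul_le_mul_of_nonneg_left ?_ (G.cond_nonneg _ _))
    rw [← hLmesh]
    nlinarith [mul_nonneg hM (G.mesh_nonneg (U := U))]

end Tiling

theorem mainTheorem5_general {d : ℕ} (hd : 1 ≤ d) (R F α : ℝ) (hF : 0 ≤ F) (hα : 0 < α) :
    ∃ C : ℝ, 0 < C ∧
      ∀ (U D : Set (EuclideanSpace ℝ (Fin d))) (G : Tiling d D), G.IsOrthogonal →
        U ⊆ Metric.closedBall 0 R →
        closure U ⊆ D →
        (∀ v ∈ G.vertsIn U, G.tile v ⊆ interior D) →
        (∀ v ∈ G.vertsIn U, Metric.diam (G.tile v) ≤ F * G.maxDualVolume α v) →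
      ∀ hC hD : EuclideanSpace ℝ (Fin d) → ℝ,
        (∀ x ∈ G.hatHull U, ContDiffAt ℝ 2 hC x) →
        (∀ x ∈ G.hat U, Laplacian.laplacian hC x = 0) →
        (∀ v ∈ G.vertsIn U, G.discreteLaplacian hD v = 0) →
        (∀ v ∈ G.bdryVerts U, hD v = hC v) →
        G.mesh U < (C * hessianBound hC (G.hatHull U))⁻¹ →
        ∀ v ∈ G.vertsIn U,
          |hD v - hC v| ≤
            C * hessianBound hC (G.hatHull U) * (G.mesh U * Real.log (G.mesh U)⁻¹) := by
  obtain ⟨k, rfl⟩ := Nat.exists_eq_add_of_le' hd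
  set K := supBoundConstant (2 * (k + 1) * volume.real
    (Metric.closedBall (0 : EuclideanSpace ℝ (Fin (k + 1))) (R + 2))) (R + 1) F α
  have hK : 0 < K := supBoundConstant_pos (by positivity) hα
  refine ⟨K + Real.exp (1 + 2 * α), by positivity, ?_⟩
  intro U D G hG hU hUD hUi hdiam hC hD hC2 hΔ hDΔ hbd hmesh z hz
  have hM : 1 ≤ hessianBound hC (G.hatHull U) := le_max_right _ _
  have hfin := G.finite_closedVerts (Metric.isBounded_closedBall.subset hU) hUD hUi
  have hpos : 0 < G.mesh U :=
    (G.diam_tile_pos hz.1).trans_le (G.diam_tile_le_mesh hfin (Or.inl hz))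
  have hL : 1 + 2 * α ≤ Real.log (G.mesh U)⁻¹ := by
    rw [Real.le_log_iff_exp_le (inv_pos.2 hpos)]
    refine le_trans ?_ ((lt_inv_comm₀ hpos (by positivity)).1 hmesh).le
    exact (le_add_of_nonneg_left hK.le).trans (le_mul_of_one_le_right (by positivity) hM)
  have hLmesh : G.mesh U = Real.exp (-Real.log (G.mesh U)⁻¹) := by
    rw [Real.log_inv, neg_neg, Real.exp_log hpos]
  refine (Tiling.abs_sub_le_supBoundConstant_mul hG hF hα hU hUD hUi hdiam (by linarith)
    (by linarith) hLmesh hC2 hΔ hDΔ hbd hz).trans ?_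
  rw [← hLmesh]
  have hε : 0 ≤ G.mesh U * Real.log (G.mesh U)⁻¹ := mul_nonneg hpos.le (by linarith)
  gcongr
  exact le_add_of_nonneg_right (Real.exp_pos _).le

theorem mainTheorem5 {d : ℕ} (hd : 1 ≤ d) (U : Set (EuclideanSpace ℝ (Fin d)))
    (hUo : IsOpen U) (hUc : IsConnected U) (hUb : Bornology.IsBounded U)
    (F α : ℝ) (hF : 0 < F) (hα : 0 < α) :
    ∃ C : ℝ, 0 < C ∧
      ∀ (D : Set (EuclideanSpace ℝ (Fin d))) (G : Tiling d D), G.IsOrthogonal →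
        closure U ⊆ D →
        (∀ v ∈ G.vertsIn U, G.tile v ⊆ interior D) →
        (∀ v ∈ G.vertsIn U, Metric.diam (G.tile v) ≤ F * G.maxDualVolume α v) →
      ∀ hC hD : EuclideanSpace ℝ (Fin d) → ℝ,
        (∀ x ∈ G.hatHull U, ContDiffAt ℝ 2 hC x) →
        (∀ x ∈ G.hat U, Laplacian.laplacian hC x = 0) →
        (∀ v ∈ G.vertsIn U, G.discreteLaplacian hD v = 0) →
        (∀ v ∈ G.bdryVerts U, hD v = hC v) →
        G.mesh U < (C * hessianBound hC (G.hatHull U))⁻¹ →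
        ∀ v ∈ G.vertsIn U,
          |hD v - hC v| ≤
            C * hessianBound hC (G.hatHull U) * (G.mesh U * Real.log (G.mesh U)⁻¹) := by
  obtain ⟨R, hU⟩ := hUb.subset_closedBall 0
  obtain ⟨C, hC, hbound⟩ := mainTheorem5_general hd R F α hF.le hα
  exact ⟨C, hC, fun D G hG => hbound U D G hG hU⟩
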